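/- \textbf{Setting.} Work on $n$ qubits ($n \ge 0$), numbered $0,\dots,n-1$, with Pauli matrices $X,Y,Z$; an \emph{unsigned Pauli string} is an element of $\{\mathbb 1,X,Y,Z\}^{\otimes n}$. An ($n$-mode) \emph{fermion--qubit mapping} is an ordered list of ordered pairs of operators $\mathfrak m=((\Gamma_0,\Gamma_1),\dots,(\Gamma_{2n-2},\Gamma_{2n-1}))$ on $(\mathbb C^2)^{\otimes n}$ for which there is a unitary $U$ with $\Gamma_k=U\gamma_kU^\dagger$ for all $k$, where $\gamma_{2i}=Z_0\cdots Z_{i-1}X_i$ and $\gamma_{2i+1}=Z_0\cdots Z_{i-1}Y_i$ are the Jordan--Wigner strings. A unit vector $|\psi\rangle$ is a \emph{vacuum state} of $\mathfrak m$ (it is unique up to a phase) if $A_i^\dagger A_i|\psi\rangle=0$ for all $i$, where $A_i=\tfrac12(\Gamma_{2i}+\mathrm i\,\Gamma_{2i+1})$. An \emph{$n$-vertex ternary tree} $T$ is a rooted tree whose $n$ vertices are labelled bijectively by $0,\dots,n-1$, in which every vertex has at most three children, occupying distinct directions among $X,Y,Z$; add unlabelled leaves so that every labelled vertex has exactly one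 child along each of its three edges $X,Y,Z$. A root-to-leaf path spells out the unsigned Pauli string acting on qubit $j$ by the label of the edge along which the path leaves $j$, and by $\mathbb 1$ if the path does not visit $j$. Let $\widetilde{\mathcal G}_T$ be the set of these strings. A \emph{$T$-based mapping} is a fermion--qubit mapping whose $2n$ operators are, up to signs, distinct elements of $\widetilde{\mathcal G}_T$. Let $|a_0\rangle,\dots,|a_{n-1}\rangle\in\{|0\rangle,|1\rangle,|+\rangle,|-\rangle,|{+\mathrm i}\rangle,|{-\mathrm i}\rangle\}$, and let $P_j\in\{X,Y,Z\}$ be the Pauli matrix of which $|a_j\rangle$ is a $\pm1$-eigenvector. The \emph{pairing algorithm} computes, for each $i$, a pair $(\widetilde\Gamma_{i,b},\widetilde\Gamma_{i,c})$ as follows. Let $B,C\in\{X,Y,Z\}$ be the unique pair with $-\mathrm i\,BC|a_i\rangle=|a_i\rangle$. Take the root-to-leaf path that runs from the root to vertex $i$, leaves $i$ along its edge $B$, and then leaves every further vertex $j$ along its edge $P_j$; let $\widetilde\Gamma_{i,b}$ be its string. Define $\widetilde\Gamma_{i,c}$ likewise with $C$ in place of $B$. If the number of labelled vertices $j$ strictly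 below $i$ on these two paths with $P_j|a_j\rangle=-|a_j\rangle$ is odd, exchange $\widetilde\Gamma_{i,b}$ and $\widetilde\Gamma_{i,c}$. \textbf{Lemma.} For every $n$-vertex ternary tree $T$ and every product stabiliser state $|\psi\rangle=\bigotimes_{i=0}^{n-1}|a_i\rangle_i$ as above: a) All $\widetilde\Gamma_{i,b},\widetilde\Gamma_{i,c}$ lie in $\widetilde{\mathcal G}_T$, and $((\widetilde\Gamma_{i,b},\widetilde\Gamma_{i,c}))_{i=0}^{n-1}$ is a $T$-based mapping with vacuum state $|\psi\rangle$. Moreover, a list $\mathfrak m$ of $n$ pairs of operators is a $T$-based mapping with all operators (unsigned) in $\widetilde{\mathcal G}_T$ and with vacuum state $|\psi\rangle$ if and only if $\mathfrak m=((\widetilde\Gamma_{\sigma(i),b},\widetilde\Gamma_{\sigma(i),c}))_{i=0}^{n-1}$ for some permutation $\sigma\in S_n$. b) A list $\mathfrak m=((\Gamma_{2i},\Gamma_{2i+1}))_{i=0}^{n-1}$ of pairs of operators is a $T$-based mapping with vacuum state $|\psi\rangle$ if and only if there is a permutation $\sigma\in S_n$ such that for every $i$, for some sign $s_i\in\{1,-1\}$,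 $$(\Gamma_{2i},\Gamma_{2i+1})=(s_i\widetilde\Gamma_{\sigma(i),b},\,s_i\widetilde\Gamma_{\sigma(i),c})\quad\text{or}\quad(\Gamma_{2i},\Gamma_{2i+1})=(s_i\widetilde\Gamma_{\sigma(i),c},\,-s_i\widetilde\Gamma_{\sigma(i),b}).$$ -/

import Mathlib

/-- Labels of the three non-identity single-qubit Pauli matrices. -/
inductive Pauli
  | X
  | Y
  | Z
  deriving DecidableEq

/-- The cyclic successor `X ↦ Y ↦ Z ↦ X`. -/
def Pauli.next : Pauli → Pauli
  | .X => .Y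
  | .Y => .Z
  | .Z => .X

/-- The single-qubit Pauli matrices. -/
noncomputable def Pauli.mat : Pauli → Matrix (Fin 2) (Fin 2) ℂ
  | .X => !![0, 1; 1, 0]
  | .Y => !![0, -Complex.I; Complex.I, 0]
  | .Z => !![1, 0; 0, -1]

/-- Names of the six single-qubit stabiliser states
`|0⟩, |1⟩, |+⟩, |-⟩, |+i⟩, |-i⟩`. -/
inductive StabState
  | zero
  | one
  | plus
  | minus
  | plusI
  | minusI
  deriving DecidableEq

/-- The state vector of a single-qubit stabiliser state. -/
noncomputable def StabState.ket : StabState → Fin 2 → ℂ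
  | .zero => ![1, 0]
  | .one => ![0, 1]
  | .plus => ![((1 / √2 : ℝ) : ℂ), ((1 / √2 : ℝ) : ℂ)]
  | .minus => ![((1 / √2 : ℝ) : ℂ), -((1 / √2 : ℝ) : ℂ)]
  | .plusI => ![((1 / √2 : ℝ) : ℂ), Complex.I * ((1 / √2 : ℝ) : ℂ)]
  | .minusI => ![((1 / √2 : ℝ) : ℂ), -(Complex.I * ((1 / √2 : ℝ) : ℂ))]

/-- The Pauli matrix of which the state is a `±1`-eigenstate. -/
def StabState.pauli : StabState → Pauli
  | .zero => .Z
  | .one => .Z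
  | .plus => .X
  | .minus => .X
  | .plusI => .Y
  | .minusI => .Y

/-- Whether the state is the `-1`-eigenstate of its Pauli matrix. -/
def StabState.isMinus : StabState → Bool
  | .zero => false
  | .one => true
  | .plus => false
  | .minus => true
  | .plusI => false
  | .minusI => true

/-- The labels `(B, C)` with `-i B C |a⟩ = |a⟩`. -/
def StabState.bc (a : StabState) : Pauli × Pauli :=
  if a.isMinus then (a.pauli.next.next, a.pauli.next) else (a.pauli.next, a.pauli.next.next)

theorem StabState.pauli_mulVec_ket (a : StabState) :
    a.pauli.mat.mulVec a.ket = (if a.isMinus then (-1 : ℂ) else 1) • a.ket := by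
  cases a <;> ext k <;> fin_cases k <;>
    simp [StabState.pauli, StabState.isMinus, StabState.ket, Pauli.mat, Matrix.mulVec,
      dotProduct, ← mul_assoc]

/-- The pair `a.bc` is the one and only pair of Pauli labels with `-i B C |a⟩ = |a⟩`. -/
theorem StabState.bc_spec (a : StabState) (B C : Pauli) :
    (-Complex.I) • (B.mat * C.mat).mulVec a.ket = a.ket ↔ (B, C) = a.bc := by
  have h2 : 0 < √2 := Real.sqrt_pos.mpr (by norm_num)
  rw [funext_iff, Fin.forall_fin_two]
  cases a <;> cases B <;> cases C <;>
    simp [StabState.bc, StabState.pauli, StabState.isMinus, StabState.ket, Pauli.mat, Pauli.next,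
      ← mul_assoc, Complex.ext_iff]
  all_goals (intro h; linarith)

/-- Rooted plane ternary trees with labelled vertices: each vertex carries a label and has one
(possibly empty) subtree in each of the directions `X`, `Y`, `Z`. The constructor `leaf` is an
unlabelled leaf, so that every labelled vertex has exactly three children. -/
inductive TTree (α : Type)
  | leaf
  | node (v : α) (child : Pauli → TTree α)

namespace TTree

variable {α : Type}

/-- The list of the labels of the vertices of a tree. -/
def labels : TTree α → List α
  | leaf => []
  | node v c => v :: ((c .X).labels ++ (c .Y).labels ++ (c .Z).labels)

/-- All root-to-leaf paths; a path is the list of its vertices, each with the label of the edge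
by which the path leaves it. -/
def paths : TTree α → List (List (α × Pauli))
  | leaf => [[]]
  | node v c =>
      (c .X).paths.map (fun l => (v, Pauli.X) :: l) ++
      (c .Y).paths.map (fun l => (v, Pauli.Y) :: l) ++
      (c .Z).paths.map (fun l => (v, Pauli.Z) :: l)

/-- The root-to-leaf path that leaves each vertex `j` via its edge with label `P j`. -/
def follow (P : α → Pauli) : TTree α → List (α × Pauli)
  | leaf => []
  | node v c => (v, P v) :: (c (P v)).follow P

/-- Search for the vertex with label `i`: returns the path from the root to this vertex
(the vertex itself excluded) and the three subtrees below it. -/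
def locate [DecidableEq α] (i : α) : TTree α → Option (List (α × Pauli) × (Pauli → TTree α))
  | leaf => none
  | node v c =>
      if v = i then some ([], c)
      else match (c .X).locate i with
        | some r => some ((v, Pauli.X) :: r.1, r.2)
        | none => match (c .Y).locate i with
          | some r => some ((v, Pauli.Y) :: r.1, r.2)
          | none => match (c .Z).locate i with
            | some r => some ((v, Pauli.Z) :: r.1, r.2)
            | none => none

/-- The pairing algorithm on paths. Let `(B, C)` be the labels with `-i B C |a_i⟩ = |a_i⟩`.
The two paths run from the root to vertex `i`, leave it via the edge `B`, respectively `C`, and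
then leave each further vertex `j` via the edge labelled by the Pauli matrix of `a j`. They are
exchanged if the number of `-1`-eigenstates among the `a j`, over the vertices `j` after `i` on
the two paths, is odd. (The value for an `i` that is not a label of the tree is irrelevant.) -/
def pairPaths [DecidableEq α] (t : TTree α) (a : α → StabState) (i : α) :
    List (α × Pauli) × List (α × Pauli) :=
  match t.locate i with
  | none => ([], [])
  | some (anc, c) =>
      let B := (a i).bc.1
      let C := (a i).bc.2
      let tailB := (c B).follow (fun j => (a j).pauli)
      let tailC := (c C).follow (fun j => (a j).pauli)
      let pathB := anc ++ (i, B) :: tailB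
      let pathC := anc ++ (i, C) :: tailC
      if Even ((tailB ++ tailC).countP (fun e => (a e.1).isMinus)) then (pathB, pathC)
      else (pathC, pathB)

end TTree

/-- An `n`-vertex ternary tree: its vertices are labelled bijectively by `Fin n`. -/
structure TernaryTree (n : ℕ) where
  tree : TTree (Fin n)
  nodup_labels : tree.labels.Nodup
  mem_labels : ∀ v : Fin n, v ∈ tree.labels

/-- Unsigned `n`-qubit Pauli strings; `none` stands for the identity on a qubit. -/
abbrev PauliString (n : ℕ) := Fin n → Option Pauli

/-- The unsigned Pauli string spelled out by a path. -/
def pathString {n : ℕ} (l : List (Fin n × Pauli)) : PauliString n :=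
  fun j => l.lookup j

/-- The set of unsigned Pauli strings of all root-to-leaf paths of a ternary tree. -/
def TernaryTree.strings {n : ℕ} (T : TernaryTree n) : Set (PauliString n) :=
  {S | ∃ l ∈ T.tree.paths, S = pathString l}

/-- The output of the pairing algorithm, as a family of pairs of unsigned Pauli strings. -/
def TernaryTree.pairing {n : ℕ} (T : TernaryTree n) (a : Fin n → StabState) (i : Fin n) :
    PauliString n × PauliString n :=
  (pathString (T.tree.pairPaths a i).1, pathString (T.tree.pairPaths a i).2)

/-- Operators on `n` qubits, as matrices in the computational basis. -/
abbrev QubitOp (n : ℕ) := Matrix (Fin n → Fin 2) (Fin n → Fin 2) ℂ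

/-- The operator of an unsigned Pauli string: the tensor product of its single-qubit matrices. -/
noncomputable def PauliString.op {n : ℕ} (S : PauliString n) : QubitOp n :=
  Matrix.of fun f g => ∏ j, ((S j).elim (1 : Matrix (Fin 2) (Fin 2) ℂ) Pauli.mat) (f j) (g j)

/-- The tensor product of single-qubit stabiliser states. -/
noncomputable def productState {n : ℕ} (a : Fin n → StabState) : (Fin n → Fin 2) → ℂ :=
  fun f => ∏ j, (a j).ket (f j)

/-- The Jordan–Wigner strings `Z_0 ⋯ Z_{i-1} X_i` (for `false`) and `Z_0 ⋯ Z_{i-1} Y_i`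
(for `true`). -/
def jordanWigner {n : ℕ} (k : Fin n × Bool) : PauliString n :=
  fun j => if j < k.1 then some .Z
    else if j = k.1 then some (if k.2 then .Y else .X) else none

/-- Ordered lists `((Γ_0, Γ_1), …, (Γ_{2n-2}, Γ_{2n-1}))` of pairs of `n`-qubit operators. -/
abbrev PairList (n : ℕ) := Fin n → QubitOp n × QubitOp n

namespace PairList

variable {n : ℕ}

/-- The `2n` operators of the list: `(i, false)` gives `Γ_{2i}` and `(i, true)` gives
`Γ_{2i+1}`. -/
def majorana (m : PairList n) (k : Fin n × Bool) : QubitOp n :=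
  if k.2 then (m k.1).2 else (m k.1).1

/-- Fermion–qubit mappings: some unitary conjugates the Jordan–Wigner strings to the operators
of the list. -/
def IsFermionQubitMapping (m : PairList n) : Prop :=
  ∃ U ∈ Matrix.unitaryGroup (Fin n → Fin 2) ℂ,
    ∀ k, m.majorana k = U * (jordanWigner k).op * U.conjTranspose

/-- The annihilation operator `A_i = (Γ_{2i} + i Γ_{2i+1}) / 2`. -/
noncomputable def annihilation (m : PairList n) (i : Fin n) : QubitOp n :=
  (1 / 2 : ℂ) • ((m i).1 + Complex.I • (m i).2)

/-- `ψ` is a vacuum state of `m`: a unit vector that is a simultaneous `0`-eigenvector of the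
number operators `A_i† A_i`. -/
def HasVacuum (m : PairList n) (ψ : (Fin n → Fin 2) → ℂ) : Prop :=
  ∑ f, ‖ψ f‖ ^ 2 = 1 ∧
    ∀ i, ((m.annihilation i).conjTranspose * m.annihilation i).mulVec ψ = 0

/-- `T`-based mappings: fermion–qubit mappings whose `2n` operators are distinct elements of the
set of strings of `T`, each up to a sign. -/
def IsTreeBased (T : TernaryTree n) (m : PairList n) : Prop :=
  m.IsFermionQubitMapping ∧
    ∃ S : Fin n × Bool → PauliString n, Function.Injective S ∧
      ∀ k, S k ∈ T.strings ∧ (m.majorana k = (S k).op ∨ m.majorana k = -(S k).op)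

/-- All operators of `m` are unsigned strings of `T`. -/
def IsUnsigned (T : TernaryTree n) (m : PairList n) : Prop :=
  ∀ k, ∃ S ∈ T.strings, m.majorana k = S.op

end PairList

/-! Two distinct root-to-leaf paths share a prefix, part at one vertex `i`, and then run through
disjoint subtrees. Their strings therefore carry different Pauli labels at `i` only and commute at
every other site, so they anticommute (`TernaryTree.exists_clash`). Any `2n` distinct strings, with
any signs, are thus Hermitian anticommuting involutions in dimension `2 ^ n`. Such a family is
unitarily equivalent to the Jordan–Wigner one (`IsMajoranaFamily.exists_unitary`), so only
distinctness and the vacuum have to be controlled.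

For Majorana operators `A† A = (1 + i Γ Γ') / 2`, hence the vacuum condition reads `Γ Γ' ψ = i ψ`.
In a product of two strings the shared prefix cancels; what remains is `B C` at the branching vertex
`i` and one Pauli at each later vertex of either path. A product state is an eigenvector only if
every site is: this forces `{B, C}` to be the two labels other than `P i`, and every later vertex
`j` to be left along `P j`. So each pair of a mapping is, up to order and signs, the pair of the
algorithm at some vertex (`TernaryTree.eq_pairing_of_mulVec`).

The eigenvalue at `(B, C)` is `i` times `-1` to the number of later `-1`-eigenstates, and the
exchange in the algorithm corrects it to `i` (`TernaryTree.pairing_mulVec`). Given the unordered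
pair, eigenvalue `i` leaves exactly the four variants of `IsBraiding`. Distinctness of the `2n`
strings makes the choice of vertices a permutation. Only one of the four variants is free of minus
signs, which gives uniqueness in the unsigned case. -/

/-! ### Majorana families and their uniqueness up to unitary equivalence -/

/-- A family of Hermitian matrices that square to one and anticommute pairwise. -/
structure IsMajoranaFamily {κ N : Type} [Fintype N] [DecidableEq N]
    (Γ : κ → Matrix N N ℂ) : Prop where
  isHermitian : ∀ k, (Γ k).conjTranspose = Γ k
  mul_self : ∀ k, Γ k * Γ k = 1
  anticomm : ∀ k k', k ≠ k' → Γ k * Γ k' = -(Γ k' * Γ k)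

/-- The linear map `M ↦ A M B` on matrices. -/
noncomputable def mulLeftRight {N : Type} [Fintype N] [DecidableEq N] (A B : Matrix N N ℂ) :
    Matrix N N ℂ →ₗ[ℂ] Matrix N N ℂ :=
  LinearMap.mulLeft ℂ A ∘ₗ LinearMap.mulRight ℂ B

/-- The matrices `M` with `Γ k * M = M * γ k` for all `k`. -/
def intertwiners {κ N : Type} [Fintype N] [DecidableEq N] (Γ γ : κ → Matrix N N ℂ) :
    Submodule ℂ (Matrix N N ℂ) where
  carrier := {M | ∀ k, Γ k * M = M * γ k}
  add_mem' := fun ha hb k => by rw [mul_add, add_mul, ha k, hb k]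
  zero_mem' := fun k => by simp
  smul_mem' := fun c M h k => by simp [h k]

/-- The sum of `M ↦ Γ_s M γ_s⁻¹` over all ordered monomials in the members of a list. -/
noncomputable def twirl {κ N : Type} [Fintype N] [DecidableEq N] (Γ γ : κ → Matrix N N ℂ) :
    List κ → Matrix N N ℂ →ₗ[ℂ] Matrix N N ℂ
  | [] => LinearMap.id
  | k :: l => twirl Γ γ l + mulLeftRight (Γ k) (γ k) ∘ₗ twirl Γ γ l

section Majorana

variable {κ N : Type} [Fintype N] [DecidableEq N] {Γ γ : κ → Matrix N N ℂ}

@[simp]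
theorem mulLeftRight_apply (A B M : Matrix N N ℂ) : mulLeftRight A B M = A * M * B := by
  simp [mulLeftRight, mul_assoc]

/-- The coefficient of `A E_ij B` at the matrix unit `E_ij` is `A i i * B j j`. This reduces the
trace of the twirl to traces of monomials. -/
theorem trace_mulLeftRight (A B : Matrix N N ℂ) :
    LinearMap.trace ℂ _ (mulLeftRight A B) = A.trace * B.trace := by
  rw [LinearMap.trace_eq_matrix_trace ℂ (Matrix.stdBasis ℂ N N), Matrix.trace,
    Fintype.sum_prod_type, Matrix.trace, Matrix.trace, Finset.sum_mul_sum]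
  refine Finset.sum_congr rfl fun i _ => Finset.sum_congr rfl fun j _ => ?_
  rw [Matrix.diag_apply, LinearMap.toMatrix_apply, Matrix.stdBasis_eq_single, mulLeftRight_apply]
  have h : ∀ M : Matrix N N ℂ, (Matrix.stdBasis ℂ N N).repr M (i, j) = M i j := by
    intro M
    simp [Matrix.stdBasis]
  rw [h, Matrix.mul_apply, Finset.sum_eq_single j]
  · simp
  · intro b _ hb
    simp [Matrix.mul_apply, hb.symm]
  · simp

/-- Each new factor is put outside, on both sides, so the `γ`-monomial comes out reversed; for
involutions this is the inverse monomial. -/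
theorem twirl_eq_sum (l : List κ) : twirl Γ γ l = ((List.sublists' l).map fun s =>
    mulLeftRight (s.map Γ).prod (s.reverse.map γ).prod).sum := by
  induction l with
  | nil => ext1 M; simp [twirl]
  | cons k l ih =>
    rw [twirl, ih, List.sublists'_cons, List.map_append, List.sum_append, List.map_map]
    congr 1
    generalize List.sublists' l = L
    induction L with
    | nil => simp
    | cons s L ihL =>
      rw [List.map_cons, List.sum_cons, LinearMap.comp_add, ihL, List.map_cons, List.sum_cons]
      congr 1
      ext1 M
      simp [mul_assoc]

namespace IsMajoranaFamily

theorem mul_prod_of_notMem (hΓ : IsMajoranaFamily Γ) (k : κ) (s : List κ) (hk : k ∉ s) :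
    Γ k * (s.map Γ).prod = (-1 : ℂ) ^ s.length • ((s.map Γ).prod * Γ k) := by
  induction s with
  | nil => simp
  | cons j s ih =>
    rw [List.mem_cons, not_or] at hk
    rw [List.map_cons, List.prod_cons, ← mul_assoc, hΓ.anticomm k j hk.1, neg_mul, mul_assoc,
      ih hk.2, List.length_cons, pow_succ, mul_smul_comm, ← mul_assoc]
    simp

theorem mul_prod_of_mem (hΓ : IsMajoranaFamily Γ) (k : κ) (s : List κ) (hs : s.Nodup)
    (hk : k ∈ s) :
    Γ k * (s.map Γ).prod = (-1 : ℂ) ^ (s.length - 1) • ((s.map Γ).prod * Γ k) := by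
  obtain ⟨s₁, s₂, rfl⟩ := List.append_of_mem hk
  have h := List.nodup_middle.1 hs
  rw [List.nodup_cons, List.mem_append, not_or] at h
  have h₁ := hΓ.mul_prod_of_notMem k s₁ h.1.1
  have h₂ := hΓ.mul_prod_of_notMem k s₂ h.1.2
  rw [List.map_append, List.prod_append, List.map_cons, List.prod_cons, ← mul_assoc, h₁]
  conv_lhs => rw [smul_mul_assoc, mul_assoc, h₂, mul_smul_comm, mul_smul_comm, smul_smul]
  simp only [mul_assoc, List.length_append, List.length_cons]
  rw [← pow_add]
  rfl

/-- Conjugation by the involution `Γ k` preserves the trace but negates `M`. -/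
theorem trace_eq_zero_of_anticomm (hΓ : IsMajoranaFamily Γ) (k : κ) (M : Matrix N N ℂ)
    (h : Γ k * M = -(M * Γ k)) : M.trace = 0 := by
  have h1 : M.trace = -M.trace := by
    calc M.trace = (M * Γ k * Γ k).trace := by rw [mul_assoc, hΓ.mul_self, mul_one]
      _ = (Γ k * M * Γ k).trace := by rw [Matrix.trace_mul_comm, mul_assoc]
      _ = -M.trace := by rw [h, neg_mul, mul_assoc, hΓ.mul_self, mul_one, Matrix.trace_neg]
  exact self_eq_neg.1 h1

/-- A monomial of even length anticommutes with each of its factors. One of odd length cannot use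
all of the evenly many indices, and it anticommutes with any member left out. -/
theorem trace_prod_eq_zero [Fintype κ] (hΓ : IsMajoranaFamily Γ) (hκ : Even (Fintype.card κ))
    (s : List κ) (hs : s.Nodup) (hne : s ≠ []) : (s.map Γ).prod.trace = 0 := by
  classical
  rcases Nat.even_or_odd s.length with he | ho
  · obtain ⟨k, t, rfl⟩ := List.exists_cons_of_ne_nil hne
    refine hΓ.trace_eq_zero_of_anticomm k _ ?_
    rw [hΓ.mul_prod_of_mem k _ hs (by simp), Odd.neg_one_pow, neg_one_smul]
    rw [List.length_cons, Nat.even_add_one, Nat.not_even_iff_odd] at he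
    simpa using he
  · obtain ⟨k, hk⟩ : ∃ k, k ∉ s := by
      by_contra! h
      have h1 : s.toFinset = Finset.univ := by ext k; simp [h k]
      have h2 := List.toFinset_card_of_nodup hs
      rw [h1, Finset.card_univ] at h2
      rw [← h2] at ho
      exact Nat.not_even_iff_odd.2 ho hκ
    refine hΓ.trace_eq_zero_of_anticomm k _ ?_
    rw [hΓ.mul_prod_of_notMem k _ hk, ho.neg_one_pow, neg_one_smul]

theorem trace_twirl [Fintype κ] (hΓ : IsMajoranaFamily Γ) (hκ : Even (Fintype.card κ))
    (l : List κ) (hl : l.Nodup) :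
    LinearMap.trace ℂ _ (twirl Γ γ l) = (Fintype.card N : ℂ) ^ 2 := by
  rw [twirl_eq_sum]
  have hnd : ∀ s ∈ List.sublists' l, s.Nodup := fun s hs =>
    (List.mem_sublists'.1 hs).nodup hl
  induction l with
  | nil => simp [trace_mulLeftRight, sq]
  | cons k l ih =>
    have h0 : ∀ L : List (List κ), (∀ s ∈ L, s.Nodup ∧ s ≠ []) → LinearMap.trace ℂ _
        ((L.map fun s => mulLeftRight (s.map Γ).prod (s.reverse.map γ).prod).sum) = 0 := by
      intro L
      induction L with
      | nil => simp
      | cons s L ihL =>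
        intro h
        rw [List.map_cons, List.sum_cons, map_add, ihL fun s hs => h s (by simp [hs]),
          trace_mulLeftRight, hΓ.trace_prod_eq_zero hκ s (h s (by simp)).1 (h s (by simp)).2]
        simp
    rw [List.sublists'_cons] at hnd ⊢
    rw [List.map_append, List.sum_append, map_add,
      ih (List.nodup_cons.1 hl).2 fun s hs => hnd s (by simp only [List.mem_append, hs, true_or]),
      h0, add_zero]
    intro s hs
    refine ⟨hnd s (List.mem_append.2 (Or.inr hs)), ?_⟩
    obtain ⟨t, _, rfl⟩ := List.mem_map.1 hs
    simp

/-- Adding the factor `k` yields `E + Γ k * E * γ k`, whose summands are exchanged by `Γ k * · * γ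
k`. Any other factor preserves the intertwining relation, because the signs from the left and the
right cancel. -/
theorem mul_twirl (hΓ : IsMajoranaFamily Γ) (hγ : IsMajoranaFamily γ) (k : κ) (l : List κ)
    (M : Matrix N N ℂ) (hM : k ∈ l ∨ Γ k * M = M * γ k) :
    Γ k * twirl Γ γ l M = twirl Γ γ l M * γ k := by
  have step : ∀ j : κ, ∀ E : Matrix N N ℂ, Γ k * E = E * γ k →
      Γ k * (Γ j * E * γ j) = Γ j * E * γ j * γ k := by
    intro j E hE
    rcases eq_or_ne k j with rfl | hkj
    · rw [← mul_assoc, ← mul_assoc, hΓ.mul_self, one_mul, mul_assoc _ (γ k), hγ.mul_self,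
        mul_one, hE]
    · rw [← mul_assoc, ← mul_assoc, hΓ.anticomm k j hkj, mul_assoc _ (γ j),
        hγ.anticomm j k hkj.symm, neg_mul, neg_mul, mul_assoc (Γ j), hE]
      simp [mul_assoc]
  induction l with
  | nil => simpa [twirl] using hM
  | cons j l ih =>
    simp only [twirl, LinearMap.add_apply, LinearMap.comp_apply, mulLeftRight_apply]
    by_cases h : k ∈ l ∨ Γ k * M = M * γ k
    · rw [mul_add, add_mul, step j _ (ih h), ih h]
    · have hkj : k = j := by
        rw [not_or] at h
        rcases hM with hM | hM
        · simpa [h.1] using hM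
        · exact absurd hM h.2
      subst hkj
      rw [mul_add, add_mul, ← mul_assoc, ← mul_assoc, hΓ.mul_self, one_mul, mul_assoc _ (γ k),
        hγ.mul_self, mul_one, add_comm]

theorem twirl_of_mem (hγ : IsMajoranaFamily γ) (l : List κ)
    (M : Matrix N N ℂ) (hM : M ∈ intertwiners Γ γ) :
    twirl Γ γ l M = (2 : ℂ) ^ l.length • M := by
  induction l with
  | nil => simp [twirl]
  | cons j l ih =>
    simp only [twirl, LinearMap.add_apply, LinearMap.comp_apply, mulLeftRight_apply, ih]
    rw [mul_smul_comm, smul_mul_assoc, hM j, mul_assoc, hγ.mul_self, mul_one, List.length_cons,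
      pow_succ, mul_smul, two_smul, smul_add]

/-- Two families of `2 n` Majorana operators in dimension `2 ^ n` have exactly one intertwiner,
up to scalars. -/
theorem finrank_intertwiners [Fintype κ] (hΓ : IsMajoranaFamily Γ) (hγ : IsMajoranaFamily γ)
    (hκ : Even (Fintype.card κ)) (hN : (Fintype.card N) ^ 2 = 2 ^ Fintype.card κ) :
    Module.finrank ℂ (intertwiners Γ γ) = 1 := by
  let l : List κ := Finset.univ.toList
  have hlen : l.length = Fintype.card κ := by simp [l]
  have h2 : (2 : ℂ) ^ Fintype.card κ ≠ 0 := pow_ne_zero _ two_ne_zero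
  -- The normalised twirl projects onto the intertwiners, so its trace is their dimension; only the
  -- empty monomial contributes to that trace.
  have hproj : LinearMap.IsProj (intertwiners Γ γ)
      (((2 : ℂ) ^ Fintype.card κ)⁻¹ • twirl Γ γ l) := by
    constructor
    · intro M
      refine Submodule.smul_mem _ _ fun k => ?_
      exact hΓ.mul_twirl hγ k l M (Or.inl (by simp [l]))
    · intro M hM
      rw [LinearMap.smul_apply, hγ.twirl_of_mem l M hM, hlen, smul_smul, inv_mul_cancel₀ h2,
        one_smul]
  have htr := hproj.trace
  rw [map_smul, hΓ.trace_twirl hκ l (Finset.nodup_toList _), smul_eq_mul] at htr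
  have h3 : (Fintype.card N : ℂ) ^ 2 = (2 : ℂ) ^ Fintype.card κ := by exact_mod_cast hN
  rw [h3, inv_mul_cancel₀ h2] at htr
  exact_mod_cast htr.symm

/-- Two families of `2 n` Majorana operators in dimension `2 ^ n` are unitarily equivalent. -/
theorem exists_unitary [Fintype κ] (hΓ : IsMajoranaFamily Γ) (hγ : IsMajoranaFamily γ)
    (hκ : Even (Fintype.card κ)) (hN : (Fintype.card N) ^ 2 = 2 ^ Fintype.card κ) :
    ∃ U ∈ Matrix.unitaryGroup N ℂ, ∀ k, Γ k = U * γ k * U.conjTranspose := by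
  obtain ⟨⟨V, hV⟩, hV0, -⟩ := finrank_eq_one_iff'.1 (hΓ.finrank_intertwiners hγ hκ hN)
  have hV0 : V ≠ 0 := fun h => hV0 (Subtype.ext h)
  -- Schur's lemma for `γ`: the count applied to `γ` against itself shows that its commutant
  -- consists of scalars, and `V† V` lies in this commutant.
  obtain ⟨⟨W, hW⟩, hW0, hspan⟩ := finrank_eq_one_iff'.1 (hγ.finrank_intertwiners hγ hκ hN)
  have h1 : (1 : Matrix N N ℂ) ∈ intertwiners γ γ := fun k => by simp
  have hVV : V.conjTranspose * V ∈ intertwiners γ γ := by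
    intro k
    have h := congrArg Matrix.conjTranspose (hV k)
    rw [Matrix.conjTranspose_mul, Matrix.conjTranspose_mul, hΓ.isHermitian,
      hγ.isHermitian] at h
    rw [← mul_assoc, ← h, mul_assoc, hV k, mul_assoc]
  obtain ⟨c₁, hc₁⟩ := hspan ⟨1, h1⟩
  obtain ⟨c₂, hc₂⟩ := hspan ⟨_, hVV⟩
  have hc₁ : c₁ • W = 1 := congrArg Subtype.val hc₁
  have hc₂ : c₂ • W = V.conjTranspose * V := congrArg Subtype.val hc₂
  obtain ⟨p, q, hpq⟩ : ∃ p q, V p q ≠ 0 := by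
    by_contra! h
    exact hV0 (Matrix.ext h)
  have hc₁0 : c₁ ≠ 0 := by
    rintro rfl
    have := congrFun (congrFun hc₁ p) p
    simp at this
  obtain ⟨c, hc⟩ : ∃ c : ℂ, V.conjTranspose * V = c • 1 :=
    ⟨c₂ * c₁⁻¹, by rw [← hc₁, smul_smul, mul_assoc, inv_mul_cancel₀ hc₁0, mul_one, hc₂]⟩
  -- The scalar is the squared norm of a nonzero column of `V`, hence positive, and `V` can be
  -- rescaled by its inverse square root.
  have hcr : c = ((∑ i, ‖V i q‖ ^ 2 : ℝ) : ℂ) := by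
    have := congrFun (congrFun hc q) q
    rw [Matrix.mul_apply] at this
    simp only [Matrix.conjTranspose_apply, Matrix.smul_apply, Matrix.one_apply_eq, smul_eq_mul,
      mul_one] at this
    rw [← this]
    push_cast
    refine Finset.sum_congr rfl fun i _ => ?_
    exact Complex.conj_mul' _
  have hpos : 0 < ∑ i, ‖V i q‖ ^ 2 :=
    Finset.sum_pos' (fun i _ => by positivity) ⟨p, Finset.mem_univ _, by positivity⟩
  set r : ℝ := ∑ i, ‖V i q‖ ^ 2 with hr
  let d : ℂ := (((√r)⁻¹ : ℝ) : ℂ)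
  have hd : d * d * c = 1 := by
    rw [hcr, ← Complex.ofReal_mul, ← Complex.ofReal_mul, ← mul_inv, Real.mul_self_sqrt hpos.le,
      inv_mul_cancel₀ hpos.ne', Complex.ofReal_one]
  have hdstar : star d = d := Complex.conj_ofReal _
  have hU : (d • V).conjTranspose * (d • V) = 1 := by
    rw [Matrix.conjTranspose_smul, hdstar, smul_mul_smul_comm, hc, smul_smul, hd, one_smul]
  have hU' : (d • V) * (d • V).conjTranspose = 1 := mul_eq_one_comm.1 hU
  refine ⟨d • V, Matrix.mem_unitaryGroup_iff.2 hU', fun k => ?_⟩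
  rw [smul_mul_assoc, ← hV k, ← mul_smul_comm, mul_assoc, hU', mul_one]

end IsMajoranaFamily

end Majorana

/-! ### Tensor products of single-qubit matrices and vectors -/

/-- The tensor product of single-qubit matrices. -/
def tensorOp {n : ℕ} (M : Fin n → Matrix (Fin 2) (Fin 2) ℂ) : QubitOp n :=
  Matrix.of fun f g => ∏ j, M j (f j) (g j)

/-- The tensor product of single-qubit vectors. -/
def tensorVec {n : ℕ} (v : Fin n → Fin 2 → ℂ) : (Fin n → Fin 2) → ℂ :=
  fun f => ∏ j, v j (f j)

/-- The matrix of a Pauli label, with `none` standing for the identity. -/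
noncomputable def siteMat (p : Option Pauli) : Matrix (Fin 2) (Fin 2) ℂ :=
  p.elim 1 Pauli.mat

/-- Two Pauli strings that differ by distinct Pauli labels at the site `i` and nowhere else. -/
def ClashOnlyAt {n : ℕ} (S S' : PauliString n) (i : Fin n) : Prop :=
  (∃ B C, B ≠ C ∧ S i = some B ∧ S' i = some C) ∧
    ∀ j, j ≠ i → S j = S' j ∨ S j = none ∨ S' j = none

section Tensor

variable {n : ℕ}

theorem tensorOp_mul (M M' : Fin n → Matrix (Fin 2) (Fin 2) ℂ) :
    tensorOp M * tensorOp M' = tensorOp fun j => M j * M' j := by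
  ext f g
  simp only [tensorOp, Matrix.mul_apply, Matrix.of_apply]
  rw [Finset.prod_univ_sum, Fintype.piFinset_univ]
  exact Finset.sum_congr rfl fun x _ => Finset.prod_mul_distrib.symm

theorem tensorOp_one : tensorOp (fun _ : Fin n => 1) = 1 := by
  ext f g
  simp only [tensorOp, Matrix.of_apply, Matrix.one_apply]
  by_cases h : f = g
  · simp [h]
  · obtain ⟨j, hj⟩ := Function.ne_iff.1 h
    rw [if_neg h]
    exact Finset.prod_eq_zero (Finset.mem_univ j) (by simp [hj])

theorem tensorOp_smul (c : Fin n → ℂ) (M : Fin n → Matrix (Fin 2) (Fin 2) ℂ) :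
    tensorOp (fun j => c j • M j) = (∏ j, c j) • tensorOp M := by
  ext f g
  simp [tensorOp, Finset.prod_mul_distrib]

theorem conjTranspose_tensorOp (M : Fin n → Matrix (Fin 2) (Fin 2) ℂ) :
    (tensorOp M).conjTranspose = tensorOp fun j => (M j).conjTranspose := by
  ext f g
  simp [tensorOp, Matrix.conjTranspose_apply]

theorem tensorOp_mulVec (M : Fin n → Matrix (Fin 2) (Fin 2) ℂ) (v : Fin n → Fin 2 → ℂ) :
    (tensorOp M).mulVec (tensorVec v) = tensorVec fun j => (M j).mulVec (v j) := by
  ext f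
  simp only [tensorOp, tensorVec, Matrix.mulVec, dotProduct, Matrix.of_apply]
  rw [Finset.prod_univ_sum, Fintype.piFinset_univ]
  exact Finset.sum_congr rfl fun x _ => Finset.prod_mul_distrib.symm

theorem tensorVec_smul (c : Fin n → ℂ) (v : Fin n → Fin 2 → ℂ) :
    tensorVec (fun j => c j • v j) = (∏ j, c j) • tensorVec v := by
  ext f
  simp [tensorVec, Finset.prod_mul_distrib]

/-- If two product vectors are proportional and the first one is nonzero at each site, then the
factors are proportional. -/
theorem exists_smul_of_tensorVec_eq {v w : Fin n → Fin 2 → ℂ} {c : ℂ}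
    (h : tensorVec v = c • tensorVec w) (hv : ∀ j, v j ≠ 0) (j : Fin n) :
    ∃ d : ℂ, v j = d • w j := by
  -- Freezing all coordinates but `j` at a point where the factors of `v` do not vanish isolates the
  -- factor at `j`.
  choose f hf using fun k => Function.ne_iff.1 (hv k)
  have hup : ∀ (u : Fin n → Fin 2 → ℂ) (x : Fin 2), tensorVec u (Function.update f j x) =
      u j x * ∏ k ∈ Finset.univ.erase j, u k (f k) := by
    intro u x
    rw [tensorVec, ← Finset.mul_prod_erase _ _ (Finset.mem_univ j), Function.update_self]
    congr 1
    refine Finset.prod_congr rfl fun k hk => ?_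
    rw [Function.update_of_ne (Finset.ne_of_mem_erase hk)]
  have h0 : ∏ k ∈ Finset.univ.erase j, v k (f k) ≠ 0 :=
    Finset.prod_ne_zero_iff.2 fun k _ => by simpa using hf k
  refine ⟨c * (∏ k ∈ Finset.univ.erase j, w k (f k)) / ∏ k ∈ Finset.univ.erase j, v k (f k), ?_⟩
  ext x
  have hx := congrFun h (Function.update f j x)
  rw [Pi.smul_apply, hup, hup, smul_eq_mul] at hx
  rw [Pi.smul_apply, smul_eq_mul, div_mul_eq_mul_div, eq_div_iff h0, hx]
  ring

end Tensor

/-! ### Pauli matrices and stabiliser states on one qubit -/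

section Site

theorem Pauli.mat_mul_self (B : Pauli) : B.mat * B.mat = 1 := by
  cases B <;> ext i j <;> fin_cases i <;> fin_cases j <;> simp [Pauli.mat]

theorem Pauli.conjTranspose_mat (B : Pauli) : B.mat.conjTranspose = B.mat := by
  cases B <;> ext i j <;> fin_cases i <;> fin_cases j <;>
    simp [Pauli.mat, Matrix.conjTranspose_apply]

theorem Pauli.mat_anticomm {B C : Pauli} (h : B ≠ C) : B.mat * C.mat = -(C.mat * B.mat) := by
  cases B <;> cases C <;> first | exact absurd rfl h | skip
  all_goals ext i j; fin_cases i <;> fin_cases j <;> simp [Pauli.mat]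

theorem siteMat_mul_self (p : Option Pauli) : siteMat p * siteMat p = 1 := by
  cases p with
  | none => simp [siteMat]
  | some B => exact B.mat_mul_self

theorem conjTranspose_siteMat (p : Option Pauli) : (siteMat p).conjTranspose = siteMat p := by
  cases p with
  | none => simp [siteMat]
  | some B => exact B.conjTranspose_mat

theorem siteMat_comm {p q : Option Pauli} (h : p = q ∨ p = none ∨ q = none) :
    siteMat p * siteMat q = siteMat q * siteMat p := by
  rcases h with rfl | rfl | rfl <;> simp [siteMat]

theorem StabState.ket_ne_zero (a : StabState) : a.ket ≠ 0 := by
  intro h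
  have h0 := congrFun h 0
  have h1 := congrFun h 1
  cases a <;> simp [StabState.ket] at h0 h1

theorem StabState.norm_ket (a : StabState) : ∑ x, ‖a.ket x‖ ^ 2 = 1 := by
  cases a <;> simp [StabState.ket, Fin.sum_univ_two] <;> norm_num

theorem mulVec_ne_zero_of_mul_self {N : Type} [Fintype N] [DecidableEq N] {M : Matrix N N ℂ}
    (hM : M * M = 1) {v : N → ℂ} (hv : v ≠ 0) : M.mulVec v ≠ 0 := by
  intro h
  apply hv
  rw [← Matrix.one_mulVec v, ← hM, ← Matrix.mulVec_mulVec, h, Matrix.mulVec_zero]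

/-- A stabiliser state is an eigenvector of its own Pauli matrix only. -/
theorem StabState.eq_pauli_of_mulVec {a : StabState} {B : Pauli} {c : ℂ}
    (h : B.mat.mulVec a.ket = c • a.ket) : B = a.pauli := by
  by_contra hne
  have hc : c ≠ 0 := by
    rintro rfl
    exact mulVec_ne_zero_of_mul_self B.mat_mul_self a.ket_ne_zero (by rw [h, zero_smul])
  -- If `B` anticommuted with the state's own Pauli matrix, applying both orders to the state would
  -- give `±c = ∓c`, so `c = 0`.
  have h1 := congrArg (fun M => Matrix.mulVec M a.ket) (Pauli.mat_anticomm hne)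
  simp only [Matrix.neg_mulVec, ← Matrix.mulVec_mulVec, h, a.pauli_mulVec_ket,
    Matrix.mulVec_smul] at h1
  rw [smul_smul, smul_smul, ← neg_smul] at h1
  have h2 := smul_left_injective ℂ a.ket_ne_zero h1
  cases hm : a.isMinus <;> simp [hm] at h2
  · exact hc (self_eq_neg.1 h2)
  · exact hc (self_eq_neg.1 h2.symm)

/-- Since `(B C)² = -1`, the eigenvalue is `i` or `-i`; the first is the defining condition for `(B,
C)`, the second that for `(C, B)`. -/
theorem StabState.eq_bc_of_mulVec {a : StabState} {B C : Pauli} {c : ℂ} (hBC : B ≠ C)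
    (h : (B.mat * C.mat).mulVec a.ket = c • a.ket) : (B, C) = a.bc ∨ (C, B) = a.bc := by
  have h1 : B.mat * C.mat * (B.mat * C.mat) = -1 := by
    rw [Pauli.mat_anticomm hBC, neg_mul_neg, mul_assoc, ← mul_assoc B.mat,
      Pauli.mat_anticomm hBC, neg_mul, mul_neg, mul_assoc, B.mat_mul_self, mul_one,
      C.mat_mul_self]
  have h2 : (c * c) • a.ket = (-1 : ℂ) • a.ket := by
    calc (c * c) • a.ket = (B.mat * C.mat * (B.mat * C.mat)).mulVec a.ket := by
          rw [← Matrix.mulVec_mulVec, h, Matrix.mulVec_smul, h, smul_smul]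
      _ = (-1 : ℂ) • a.ket := by rw [h1, Matrix.neg_mulVec, Matrix.one_mulVec, neg_one_smul]
  have h3 : c * c = Complex.I * Complex.I := by
    rw [smul_left_injective ℂ a.ket_ne_zero h2, Complex.I_mul_I]
  rcases mul_self_eq_mul_self_iff.1 h3 with rfl | rfl
  · left
    rw [← StabState.bc_spec, h, smul_smul]
    simp
  · right
    rw [← StabState.bc_spec, Pauli.mat_anticomm hBC.symm, Matrix.neg_mulVec, h, ← neg_smul,
      smul_smul]
    simp

theorem StabState.bc_fst_ne_snd (a : StabState) : a.bc.1 ≠ a.bc.2 := by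
  cases a <;> decide

theorem StabState.bc_fst_ne_pauli (a : StabState) : a.bc.1 ≠ a.pauli := by
  cases a <;> decide

theorem StabState.bc_snd_ne_pauli (a : StabState) : a.bc.2 ≠ a.pauli := by
  cases a <;> decide

end Site

/-! ### Operators of Pauli strings -/

namespace PauliString

variable {n : ℕ}

theorem op_eq_tensorOp (S : PauliString n) : S.op = tensorOp fun j => siteMat (S j) := rfl

theorem op_mul_self (S : PauliString n) : S.op * S.op = 1 := by
  simp only [op_eq_tensorOp, tensorOp_mul, siteMat_mul_self, tensorOp_one]

theorem conjTranspose_op (S : PauliString n) : S.op.conjTranspose = S.op := by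
  simp only [op_eq_tensorOp, conjTranspose_tensorOp, conjTranspose_siteMat]

theorem op_anticomm {S S' : PauliString n} {i : Fin n} (h : ClashOnlyAt S S' i) :
    S.op * S'.op = -(S'.op * S.op) := by
  have key : ∀ j, siteMat (S j) * siteMat (S' j) =
      (if j = i then (-1 : ℂ) else 1) • (siteMat (S' j) * siteMat (S j)) := by
    intro j
    by_cases hj : j = i
    · subst hj
      obtain ⟨⟨B, C, hBC, hB, hC⟩, -⟩ := h
      rw [hB, hC, if_pos rfl, neg_one_smul]
      exact Pauli.mat_anticomm hBC
    · rw [if_neg hj, one_smul, siteMat_comm (h.2 j hj)]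
  simp only [op_eq_tensorOp, tensorOp_mul]
  simp_rw [key]
  rw [tensorOp_smul, Finset.prod_ite_eq' Finset.univ i, if_pos (Finset.mem_univ i), neg_one_smul]

theorem op_mul_op_mulVec (S S' : PauliString n) (a : Fin n → StabState) :
    (S.op * S'.op).mulVec (productState a) =
      tensorVec fun j => (siteMat (S j) * siteMat (S' j)).mulVec (a j).ket := by
  rw [op_eq_tensorOp, op_eq_tensorOp, tensorOp_mul]
  exact tensorOp_mulVec _ _

/-- If a product of two Pauli strings has a product state as an eigenvector, then each of its
factors has the respective state as an eigenvector. -/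
theorem exists_site_eigenvalue {S S' : PauliString n} {a : Fin n → StabState} {c : ℂ}
    (h : (S.op * S'.op).mulVec (productState a) = c • productState a) (j : Fin n) :
    ∃ d : ℂ, (siteMat (S j) * siteMat (S' j)).mulVec (a j).ket = d • (a j).ket := by
  rw [op_mul_op_mulVec] at h
  refine exists_smul_of_tensorVec_eq (w := fun j => (a j).ket) h (fun k => ?_) j
  rw [← Matrix.mulVec_mulVec]
  exact mulVec_ne_zero_of_mul_self (siteMat_mul_self _)
    (mulVec_ne_zero_of_mul_self (siteMat_mul_self _) (a k).ket_ne_zero)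

theorem op_ne_neg_op (S : PauliString n) : S.op ≠ -S.op := by
  intro h
  have h1 : S.op = 0 := Matrix.ext fun f g => self_eq_neg.1 (congrFun (congrFun h f) g)
  have h2 := S.op_mul_self
  rw [h1, zero_mul] at h2
  exact zero_ne_one h2

end PauliString

theorem sum_norm_productState {n : ℕ} (a : Fin n → StabState) :
    ∑ f, ‖productState a f‖ ^ 2 = 1 := by
  have h : ∏ j, ∑ x, ‖(a j).ket x‖ ^ 2 = 1 :=
    Finset.prod_eq_one fun j _ => (a j).norm_ket
  rw [Finset.prod_univ_sum, Fintype.piFinset_univ] at h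
  rw [← h]
  refine Finset.sum_congr rfl fun f _ => ?_
  rw [productState, norm_prod, Finset.prod_pow]

theorem productState_ne_zero {n : ℕ} (a : Fin n → StabState) : productState a ≠ 0 := by
  intro h
  have := sum_norm_productState a
  simp [h] at this

/-! ### Fermion–qubit mappings from clashing strings, and the vacuum condition -/

/-- Signed Pauli strings that clash at exactly one site form a Majorana family. -/
theorem isMajoranaFamily_of_clash {n : ℕ} {κ : Type} {Γ : κ → QubitOp n} {S : κ → PauliString n}
    (hΓ : ∀ k, Γ k = (S k).op ∨ Γ k = -(S k).op)
    (hS : ∀ k k', k ≠ k' → ∃ i, ClashOnlyAt (S k) (S k') i) : IsMajoranaFamily Γ where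
  isHermitian k := by
    rcases hΓ k with h | h <;> simp [h, PauliString.conjTranspose_op]
  mul_self k := by
    rcases hΓ k with h | h <;> simp [h, PauliString.op_mul_self]
  anticomm k k' hk := by
    obtain ⟨i, hi⟩ := hS k k' hk
    have h0 := PauliString.op_anticomm hi
    rcases hΓ k with h | h <;> rcases hΓ k' with h' | h' <;> simp [h, h', h0]

theorem jordanWigner_clash {n : ℕ} (k k' : Fin n × Bool) (h : k ≠ k') :
    ∃ i, ClashOnlyAt (jordanWigner k) (jordanWigner k') i := by
  obtain ⟨i, b⟩ := k
  obtain ⟨i', b'⟩ := k'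
  rcases lt_trichotomy i i' with hlt | rfl | hlt
  · refine ⟨i, ⟨_, _, ?_, by simp [jordanWigner]; rfl, by simp [jordanWigner, hlt]; rfl⟩, ?_⟩
    · cases b <;> simp
    · intro j hj
      by_cases h1 : j < i
      · left; simp [jordanWigner, h1, h1.trans hlt]
      · right; left; simp [jordanWigner, h1, hj]
  · have hb : b ≠ b' := fun hb => h (by rw [hb])
    refine ⟨i, ⟨_, _, ?_, by simp [jordanWigner]; rfl, by simp [jordanWigner]; rfl⟩, ?_⟩
    · cases b <;> cases b' <;> simp at hb ⊢
    · intro j hj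
      left; simp [jordanWigner, hj]
  · refine ⟨i', ⟨_, _, ?_, by simp [jordanWigner, hlt]; rfl, by simp [jordanWigner]; rfl⟩, ?_⟩
    · cases b' <;> simp
    · intro j hj
      by_cases h1 : j < i'
      · left; simp [jordanWigner, h1, h1.trans hlt]
      · right; right; simp [jordanWigner, h1, hj]

/-- Uniqueness of the Majorana representation is applied against Jordan–Wigner, with `2n` operators
in dimension `2 ^ n`; no unitary has to be read off a tree. -/
theorem IsMajoranaFamily.isFermionQubitMapping {n : ℕ} {m : PairList n}
    (h : IsMajoranaFamily m.majorana) : m.IsFermionQubitMapping := by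
  have hJ : IsMajoranaFamily fun k : Fin n × Bool => (jordanWigner k).op :=
    isMajoranaFamily_of_clash (fun _ => Or.inl rfl) jordanWigner_clash
  refine h.exists_unitary hJ ?_ ?_
  · simp
  · simp [← pow_mul]

/-- For Majorana operators, the vacuum condition `A† A ψ = 0` says `Γ Γ' ψ = i ψ`. -/
theorem annihilation_mulVec_eq_zero_iff {n : ℕ} {m : PairList n}
    (h : IsMajoranaFamily m.majorana) (i : Fin n) (ψ : (Fin n → Fin 2) → ℂ) :
    ((m.annihilation i).conjTranspose * m.annihilation i).mulVec ψ = 0 ↔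
      ((m i).1 * (m i).2).mulVec ψ = Complex.I • ψ := by
  have h1 : (m i).1.conjTranspose = (m i).1 := h.isHermitian (i, false)
  have h2 : (m i).2.conjTranspose = (m i).2 := h.isHermitian (i, true)
  have h3 : (m i).1 * (m i).1 = 1 := h.mul_self (i, false)
  have h4 : (m i).2 * (m i).2 = 1 := h.mul_self (i, true)
  have h5 : (m i).2 * (m i).1 = -((m i).1 * (m i).2) :=
    h.anticomm (i, true) (i, false) (by simp)
  -- The two squares each give `1`, and anticommutation makes the two cross terms equal.
  have key : (m.annihilation i).conjTranspose * m.annihilation i =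
      (1 / 2 : ℂ) • (1 + Complex.I • ((m i).1 * (m i).2)) := by
    rw [PairList.annihilation, Matrix.conjTranspose_smul, Matrix.conjTranspose_add,
      Matrix.conjTranspose_smul, h1, h2, smul_mul_smul_comm, add_mul, mul_add, mul_add]
    simp only [mul_smul_comm, smul_mul_assoc, smul_smul, h3, h4, h5, smul_neg]
    have hI : star Complex.I = -Complex.I := Complex.conj_I
    rw [hI]
    have : Complex.I * -Complex.I = 1 := by simp
    rw [this]
    simp only [neg_smul, neg_neg, one_smul]
    have h6 : star (1 / 2 : ℂ) * (1 / 2) = 1 / 4 := by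
      simp; norm_num
    rw [h6]
    module
  rw [key, Matrix.smul_mulVec, smul_eq_zero_iff_right (by norm_num), Matrix.add_mulVec,
    Matrix.one_mulVec, Matrix.smul_mulVec]
  constructor
  · intro h0
    have h7 := congrArg (fun v => Complex.I • v) h0
    simp only [smul_add, smul_smul, Complex.I_mul_I, neg_one_smul, smul_zero] at h7
    exact (add_neg_eq_zero.1 h7).symm
  · intro h0
    rw [h0, smul_smul, Complex.I_mul_I, neg_one_smul, add_neg_cancel]

/-! ### Positions and root-to-leaf paths in a ternary tree -/

namespace TTree

variable {α : Type}

/-- `t.At i anc c`: the path from the root of `t` to a vertex labelled `i` is `anc`, and the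
subtrees of this vertex are `c`. -/
inductive At : TTree α → α → List (α × Pauli) → (Pauli → TTree α) → Prop
  | root (i : α) (c : Pauli → TTree α) : At (node i c) i [] c
  | child (v : α) (c : Pauli → TTree α) (d : Pauli) {i : α} {anc : List (α × Pauli)}
      {c' : Pauli → TTree α} (h : At (c d) i anc c') : At (node v c) i ((v, d) :: anc) c'

theorem mem_labels_node {v x : α} {c : Pauli → TTree α} :
    x ∈ (node v c).labels ↔ x = v ∨ ∃ d, x ∈ (c d).labels := by
  simp only [labels, List.mem_cons, List.mem_append]
  constructor
  · rintro (h | (h | h) | h)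
    · exact Or.inl h
    · exact Or.inr ⟨_, h⟩
    · exact Or.inr ⟨_, h⟩
    · exact Or.inr ⟨_, h⟩
  · rintro (h | ⟨d, h⟩)
    · exact Or.inl h
    · cases d <;> simp [h]

theorem mem_paths_node {v : α} {c : Pauli → TTree α} {l : List (α × Pauli)} :
    l ∈ (node v c).paths ↔ ∃ d, ∃ l' ∈ (c d).paths, l = (v, d) :: l' := by
  simp only [paths, List.mem_append, List.mem_map]
  constructor
  · rintro ((⟨l', h, rfl⟩ | ⟨l', h, rfl⟩) | ⟨l', h, rfl⟩) <;> exact ⟨_, l', h, rfl⟩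
  · rintro ⟨d, l', h, rfl⟩
    cases d
    · exact Or.inl (Or.inl ⟨l', h, rfl⟩)
    · exact Or.inl (Or.inr ⟨l', h, rfl⟩)
    · exact Or.inr ⟨l', h, rfl⟩

theorem nodup_labels_node {v : α} {c : Pauli → TTree α} :
    (node v c).labels.Nodup ↔ (∀ d, v ∉ (c d).labels) ∧ (∀ d, (c d).labels.Nodup) ∧
      ∀ d d', d ≠ d' → ∀ x ∈ (c d).labels, x ∉ (c d').labels := by
  simp only [labels, List.nodup_cons, List.nodup_append, List.mem_append, not_or]
  constructor
  · rintro ⟨⟨⟨h1, h2⟩, h3⟩, ⟨h4, h5, h6⟩, h7, h8⟩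
    refine ⟨fun d => by cases d <;> assumption, fun d => by cases d <;> assumption, ?_⟩
    intro d d' hd x hx hx'
    cases d <;> cases d' <;> first | exact hd rfl | skip
    · exact h6 x hx x hx' rfl
    · exact h8 x (Or.inl hx) x hx' rfl
    · exact h6 x hx' x hx rfl
    · exact h8 x (Or.inr hx) x hx' rfl
    · exact h8 x (Or.inl hx') x hx rfl
    · exact h8 x (Or.inr hx') x hx rfl
  · rintro ⟨h1, h2, h3⟩
    refine ⟨⟨⟨h1 _, h1 _⟩, h1 _⟩, ⟨h2 _, h2 _, ?_⟩, h2 _, ?_⟩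
    · rintro x hx y hy rfl
      exact h3 _ _ (by decide) x hx hy
    · rintro x (hx | hx) y hy rfl
      · exact h3 _ _ (by decide) x hx hy
      · exact h3 _ _ (by decide) x hx hy

theorem mem_labels_of_mem_paths {t : TTree α} {l : List (α × Pauli)} (hl : l ∈ t.paths)
    {e : α × Pauli} (he : e ∈ l) : e.1 ∈ t.labels := by
  induction t generalizing l with
  | leaf => simp [paths] at hl; simp [hl] at he
  | node v c ih =>
    obtain ⟨d, l', hl', rfl⟩ := mem_paths_node.1 hl
    rw [mem_labels_node]
    rcases List.mem_cons.1 he with rfl | he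
    · exact Or.inl rfl
    · exact Or.inr ⟨d, ih d hl' he⟩

theorem nodup_keys_of_mem_paths {t : TTree α} (ht : t.labels.Nodup) {l : List (α × Pauli)}
    (hl : l ∈ t.paths) : (l.map Prod.fst).Nodup := by
  induction t generalizing l with
  | leaf => simp [paths] at hl; simp [hl]
  | node v c ih =>
    obtain ⟨d, l', hl', rfl⟩ := mem_paths_node.1 hl
    rw [nodup_labels_node] at ht
    rw [List.map_cons, List.nodup_cons]
    refine ⟨fun h => ?_, ih d (ht.2.1 d) hl'⟩
    obtain ⟨e, he, hev⟩ := List.mem_map.1 h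
    have h1 := mem_labels_of_mem_paths hl' he
    rw [hev] at h1
    exact ht.1 d h1

theorem follow_mem_paths (P : α → Pauli) (t : TTree α) : t.follow P ∈ t.paths := by
  induction t with
  | leaf => simp [follow, paths]
  | node v c ih => exact mem_paths_node.2 ⟨P v, _, ih (P v), rfl⟩

theorem eq_of_mem_follow {P : α → Pauli} {t : TTree α} {e : α × Pauli} (he : e ∈ t.follow P) :
    e.2 = P e.1 := by
  induction t with
  | leaf => simp [follow] at he
  | node v c ih =>
    rcases List.mem_cons.1 he with rfl | he
    · rfl
    · exact ih (P v) he

/-- Used in the converse direction: once every edge of a tail is known to be the prescribed one, the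
whole tail is determined. -/
theorem eq_follow {P : α → Pauli} {t : TTree α} {l : List (α × Pauli)} (hl : l ∈ t.paths)
    (h : ∀ e ∈ l, e.2 = P e.1) : l = t.follow P := by
  induction t generalizing l with
  | leaf => simpa [paths, follow] using hl
  | node v c ih =>
    obtain ⟨d, l', hl', rfl⟩ := mem_paths_node.1 hl
    have hd : d = P v := h (v, d) (by simp)
    subst hd
    rw [follow, ← ih (P v) hl' fun e he => h e (by simp [he])]

namespace At

variable {t : TTree α} {i : α} {anc : List (α × Pauli)} {c : Pauli → TTree α}

theorem mem_labels (h : At t i anc c) : i ∈ t.labels := by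
  induction h with
  | root i c => exact mem_labels_node.2 (Or.inl rfl)
  | child v c d h ih => exact mem_labels_node.2 (Or.inr ⟨d, ih⟩)

theorem mem_labels_of_child (h : At t i anc c) {B : Pauli} {x : α} (hx : x ∈ (c B).labels) :
    x ∈ t.labels := by
  induction h with
  | root i c => exact mem_labels_node.2 (Or.inr ⟨B, hx⟩)
  | child v c d h ih => exact mem_labels_node.2 (Or.inr ⟨d, ih hx⟩)

theorem nodup_child (h : At t i anc c) (ht : t.labels.Nodup) : (node i c).labels.Nodup := by
  induction h with
  | root i c => exact ht
  | child v c d h ih => exact ih ((nodup_labels_node.1 ht).2.1 d)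

theorem notMem_of_mem_anc (h : At t i anc c) (ht : t.labels.Nodup) {e : α × Pauli}
    (he : e ∈ anc) : e.1 ∉ (node i c).labels := by
  induction h with
  | root i c => simp at he
  | child v c d h ih =>
    rw [nodup_labels_node] at ht
    rcases List.mem_cons.1 he with rfl | he
    · intro hv
      refine ht.1 d ?_
      rcases mem_labels_node.1 hv with rfl | ⟨B, hB⟩
      · exact h.mem_labels
      · exact h.mem_labels_of_child hB
    · exact ih (ht.2.1 d) he

theorem append_mem_paths (h : At t i anc c) {B : Pauli} {l : List (α × Pauli)}
    (hl : l ∈ (c B).paths) : anc ++ (i, B) :: l ∈ t.paths := by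
  induction h with
  | root i c => exact mem_paths_node.2 ⟨B, l, hl, rfl⟩
  | child v c d h ih => exact mem_paths_node.2 ⟨d, _, ih hl, rfl⟩

end At

theorem exists_at {t : TTree α} {i : α} (hi : i ∈ t.labels) : ∃ anc c, At t i anc c := by
  induction t with
  | leaf => simp [labels] at hi
  | node v c ih =>
    rcases mem_labels_node.1 hi with rfl | ⟨d, hd⟩
    · exact ⟨_, _, At.root i c⟩
    · obtain ⟨anc, c', h⟩ := ih d hd
      exact ⟨_, _, At.child v c d h⟩

/-- Two distinct root-to-leaf paths part at some vertex. -/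
theorem exists_branch {t : TTree α} {l l' : List (α × Pauli)} (hl : l ∈ t.paths)
    (hl' : l' ∈ t.paths) (hne : l ≠ l') :
    ∃ i anc c, At t i anc c ∧ ∃ B C, B ≠ C ∧ ∃ r ∈ (c B).paths, ∃ r' ∈ (c C).paths,
      l = anc ++ (i, B) :: r ∧ l' = anc ++ (i, C) :: r' := by
  induction t generalizing l l' with
  | leaf => simp [paths] at hl hl'; exact absurd (hl.trans hl'.symm) hne
  | node v c ih =>
    obtain ⟨B, r, hr, rfl⟩ := mem_paths_node.1 hl
    obtain ⟨C, r', hr', rfl⟩ := mem_paths_node.1 hl'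
    by_cases hBC : B = C
    · subst hBC
      obtain ⟨i, anc, c', hat, B', C', hne', s, hs, s', hs', rfl, rfl⟩ :=
        ih B hr hr' fun h => hne (by rw [h])
      exact ⟨i, _, c', At.child v c B hat, B', C', hne', s, hs, s', hs', rfl, rfl⟩
    · exact ⟨v, [], c, At.root v c, B, C, hBC, r, hr, r', hr', rfl, rfl⟩

theorem locate_eq_none [DecidableEq α] {t : TTree α} {i : α} (hi : i ∉ t.labels) :
    t.locate i = none := by
  induction t with
  | leaf => rfl
  | node v c ih =>
    rw [mem_labels_node, not_or, not_exists] at hi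
    rw [locate, if_neg (Ne.symm hi.1), ih _ (hi.2 _), ih _ (hi.2 _), ih _ (hi.2 _)]

/-- Distinct labels make the search fail in every subtree but the right one. Positions can then be
handled by induction on `At` instead of through the nested search. -/
theorem At.locate_eq [DecidableEq α] {t : TTree α} {i : α} {anc : List (α × Pauli)}
    {c : Pauli → TTree α} (h : At t i anc c) (ht : t.labels.Nodup) :
    t.locate i = some (anc, c) := by
  induction h with
  | root i c => rw [locate, if_pos rfl]
  | @child v c d i anc c' h ih =>
    rw [nodup_labels_node] at ht
    have hv : v ≠ i := by
      rintro rfl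
      exact ht.1 d h.mem_labels
    have hd : ∀ d', d ≠ d' → (c d').locate i = none := fun d' hd' =>
      locate_eq_none (ht.2.2 d d' hd' i h.mem_labels)
    rw [locate, if_neg hv]
    have ih := ih (ht.2.1 d)
    cases d
    · rw [ih]
    · rw [hd .X (by decide), ih]
    · rw [hd .X (by decide), hd .Y (by decide), ih]

end TTree

/-! ### Strings of paths that part at a vertex -/

section Strings

variable {n : ℕ}

theorem lookup_eq_none_of_forall {l : List (Fin n × Pauli)} {j : Fin n}
    (h : ∀ e ∈ l, e.1 ≠ j) : l.lookup j = none := by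
  rw [List.lookup_eq_none_iff]
  intro e he
  simpa using (h e he).symm

theorem mem_of_lookup_eq_some {l : List (Fin n × Pauli)} {j : Fin n} {B : Pauli}
    (h : l.lookup j = some B) : (j, B) ∈ l := by
  obtain ⟨l₁, l₂, rfl, -⟩ := List.lookup_eq_some_iff.1 h
  simp

theorem lookup_eq_some_of_mem {l : List (Fin n × Pauli)} (hl : (l.map Prod.fst).Nodup)
    {e : Fin n × Pauli} (he : e ∈ l) : l.lookup e.1 = some e.2 := by
  obtain ⟨l₁, l₂, rfl⟩ := List.append_of_mem he
  rw [List.map_append, List.map_cons] at hl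
  rw [List.lookup_eq_some_iff]
  refine ⟨l₁, l₂, rfl, fun p hp => ?_⟩
  have h := (List.nodup_middle.1 hl)
  rw [List.nodup_cons, List.mem_append, not_or] at h
  have : e.1 ≠ p.1 := fun h' => h.1.1 (h' ▸ List.mem_map_of_mem hp)
  simpa using this

/-- The strings of two paths that part at a vertex `i`. -/
theorem pathString_branch {t : TTree (Fin n)} (ht : t.labels.Nodup) {i : Fin n}
    {anc : List (Fin n × Pauli)} {c : Pauli → TTree (Fin n)} (h : t.At i anc c) {B C : Pauli}
    (hBC : B ≠ C) {r r' : List (Fin n × Pauli)} (hr : r ∈ (c B).paths) (hr' : r' ∈ (c C).paths) :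
    pathString (anc ++ (i, B) :: r) i = some B ∧ pathString (anc ++ (i, C) :: r') i = some C ∧
    ∀ j, j ≠ i →
      (pathString (anc ++ (i, B) :: r) j = pathString (anc ++ (i, C) :: r') j ∧
        r.lookup j = none ∧ r'.lookup j = none) ∨
      (pathString (anc ++ (i, B) :: r) j = r.lookup j ∧
        pathString (anc ++ (i, C) :: r') j = r'.lookup j ∧
        (r.lookup j = none ∨ r'.lookup j = none)) := by
  have hanc := fun e he => h.notMem_of_mem_anc ht (e := e) he
  have hc := TTree.nodup_labels_node.1 (h.nodup_child ht)
  have hi : anc.lookup i = none := lookup_eq_none_of_forall fun e he hei =>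
    hanc e he (hei ▸ TTree.mem_labels_node.2 (Or.inl rfl))
  have hlk : ∀ (D : Pauli) (s : List (Fin n × Pauli)) (j : Fin n), j ≠ i →
      pathString (anc ++ (i, D) :: s) j = (anc.lookup j).or (s.lookup j) := by
    intro D s j hj
    rw [pathString, List.lookup_append, List.lookup_cons]
    have : (j == i) = false := by simpa using hj
    rw [this]
  refine ⟨by simp [pathString, List.lookup_append, hi], by simp [pathString,
    List.lookup_append, hi], fun j hj => ?_⟩
  rw [hlk _ _ _ hj, hlk _ _ _ hj]
  have hsub : ∀ (D : Pauli) (s : List (Fin n × Pauli)), s ∈ (c D).paths →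
      j ∉ (c D).labels → s.lookup j = none := fun D s hs hjD =>
    lookup_eq_none_of_forall fun e he hej =>
      hjD (hej ▸ TTree.mem_labels_of_mem_paths hs he)
  -- At an ancestor both strings read the shared prefix, and its label does not recur below.
  -- Elsewhere the subtrees along `B` and `C` have disjoint labels, so at most one tail visits `j`.
  cases hl : anc.lookup j with
  | some D =>
    have hj' := hanc _ (mem_of_lookup_eq_some hl)
    rw [TTree.mem_labels_node, not_or, not_exists] at hj'
    left
    exact ⟨by simp, hsub B r hr (hj'.2 B), hsub C r' hr' (hj'.2 C)⟩
  | none =>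
    right
    refine ⟨by simp, by simp, ?_⟩
    by_cases hjB : j ∈ (c B).labels
    · exact Or.inr (hsub C r' hr' (hc.2.2 B C hBC j hjB))
    · exact Or.inl (hsub B r hr hjB)

theorem clashOnlyAt_branch {t : TTree (Fin n)} (ht : t.labels.Nodup) {i : Fin n}
    {anc : List (Fin n × Pauli)} {c : Pauli → TTree (Fin n)} (h : t.At i anc c) {B C : Pauli}
    (hBC : B ≠ C) {r r' : List (Fin n × Pauli)} (hr : r ∈ (c B).paths) (hr' : r' ∈ (c C).paths) :
    ClashOnlyAt (pathString (anc ++ (i, B) :: r)) (pathString (anc ++ (i, C) :: r')) i := by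
  obtain ⟨h1, h2, h3⟩ := pathString_branch ht h hBC hr hr'
  refine ⟨⟨B, C, hBC, h1, h2⟩, fun j hj => ?_⟩
  rcases h3 j hj with ⟨h4, -⟩ | ⟨h4, h5, h6⟩
  · exact Or.inl h4
  · rw [h4, h5]
    exact Or.inr h6

theorem pathString_injOn {t : TTree (Fin n)} (ht : t.labels.Nodup)
    {l l' : List (Fin n × Pauli)} (hl : l ∈ t.paths) (hl' : l' ∈ t.paths)
    (h : pathString l = pathString l') : l = l' := by
  by_contra hne
  obtain ⟨i, anc, c, hat, B, C, hBC, r, hr, r', hr', rfl, rfl⟩ :=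
    TTree.exists_branch hl hl' hne
  obtain ⟨h1, h2, -⟩ := pathString_branch ht hat hBC hr hr'
  rw [h, h2] at h1
  exact hBC (Option.some.inj h1).symm

theorem TernaryTree.exists_clash (T : TernaryTree n) {S S' : PauliString n} (hS : S ∈ T.strings)
    (hS' : S' ∈ T.strings) (hne : S ≠ S') : ∃ i, ClashOnlyAt S S' i := by
  obtain ⟨l, hl, rfl⟩ := hS
  obtain ⟨l', hl', rfl⟩ := hS'
  obtain ⟨i, anc, c, hat, B, C, hBC, r, hr, r', hr', rfl, rfl⟩ :=
    TTree.exists_branch hl hl' fun h => hne (by rw [h])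
  exact ⟨i, clashOnlyAt_branch T.nodup_labels hat hBC hr hr'⟩

end Strings

/-! ### The pairing algorithm and the product state -/

/-- The path that leaves the vertex `i` along its edge `B` and then follows the Pauli labels of
the states `a`, as a function of the position of `i`. -/
def branchPath {n : ℕ} (a : Fin n → StabState) (anc : List (Fin n × Pauli)) (i : Fin n)
    (c : Pauli → TTree (Fin n)) (B : Pauli) : List (Fin n × Pauli) :=
  anc ++ (i, B) :: (c B).follow fun j => (a j).pauli

section Pairing

variable {n : ℕ} {T : TernaryTree n} {a : Fin n → StabState} {i : Fin n}
  {anc : List (Fin n × Pauli)} {c : Pauli → TTree (Fin n)}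

theorem TernaryTree.exists_at (T : TernaryTree n) (i : Fin n) : ∃ anc c, T.tree.At i anc c :=
  TTree.exists_at (T.mem_labels i)

theorem TTree.At.pairing_eq (h : T.tree.At i anc c) : T.pairing a i =
    if Even (((c (a i).bc.1).follow (fun j => (a j).pauli) ++
        (c (a i).bc.2).follow (fun j => (a j).pauli)).countP fun e => (a e.1).isMinus) then
      (pathString (branchPath a anc i c (a i).bc.1), pathString (branchPath a anc i c (a i).bc.2))
    else
      (pathString (branchPath a anc i c (a i).bc.2),
        pathString (branchPath a anc i c (a i).bc.1)) := by
  rw [TernaryTree.pairing, TTree.pairPaths, h.locate_eq T.nodup_labels]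
  dsimp only
  split_ifs <;> rfl

theorem TTree.At.pairing_cases (a : Fin n → StabState) (h : T.tree.At i anc c) :
    T.pairing a i = (pathString (branchPath a anc i c (a i).bc.1),
      pathString (branchPath a anc i c (a i).bc.2)) ∨
    T.pairing a i = (pathString (branchPath a anc i c (a i).bc.2),
      pathString (branchPath a anc i c (a i).bc.1)) := by
  rw [h.pairing_eq]
  split_ifs
  · exact Or.inl rfl
  · exact Or.inr rfl

theorem TTree.At.branchPath_mem_paths (a : Fin n → StabState) (h : T.tree.At i anc c)
    (B : Pauli) : branchPath a anc i c B ∈ T.tree.paths :=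
  h.append_mem_paths (TTree.follow_mem_paths _ _)

theorem TernaryTree.pairing_mem_strings (T : TernaryTree n) (a : Fin n → StabState) (i : Fin n) :
    (T.pairing a i).1 ∈ T.strings ∧ (T.pairing a i).2 ∈ T.strings := by
  obtain ⟨anc, c, h⟩ := T.exists_at i
  rcases h.pairing_cases a with h1 | h1 <;> rw [h1] <;>
    exact ⟨⟨_, h.branchPath_mem_paths a _, rfl⟩, ⟨_, h.branchPath_mem_paths a _, rfl⟩⟩

/-- The branching vertex is the last one that the path leaves along an edge other than the one
prescribed by the state. -/
theorem getLast_filter_branchPath {B : Pauli} (hB : B ≠ (a i).pauli) :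
    ((branchPath a anc i c B).filter fun e => e.2 ≠ (a e.1).pauli).getLast? = some (i, B) := by
  have h : ((c B).follow fun j => (a j).pauli).filter (fun e => e.2 ≠ (a e.1).pauli) = [] := by
    rw [List.filter_eq_nil_iff]
    intro e he
    simpa using TTree.eq_of_mem_follow he
  rw [branchPath, List.filter_append, List.filter_cons_of_pos (by simpa using hB), h]
  simp

/-- The members of the output of the pairing algorithm, as a single family. -/
def TernaryTree.pairingString (T : TernaryTree n) (a : Fin n → StabState) (k : Fin n × Bool) :
    PauliString n :=
  if k.2 then (T.pairing a k.1).2 else (T.pairing a k.1).1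

theorem TernaryTree.pairingString_mem (T : TernaryTree n) (a : Fin n → StabState)
    (k : Fin n × Bool) : T.pairingString a k ∈ T.strings := by
  rw [TernaryTree.pairingString]
  split_ifs
  · exact (T.pairing_mem_strings a k.1).2
  · exact (T.pairing_mem_strings a k.1).1

theorem TTree.At.pairing_fst_ne_snd (h : T.tree.At i anc c) :
    (T.pairing a i).1 ≠ (T.pairing a i).2 := by
  have hne : pathString (branchPath a anc i c (a i).bc.1) ≠
      pathString (branchPath a anc i c (a i).bc.2) := by
    intro h1
    obtain ⟨h2, h3, -⟩ := pathString_branch T.nodup_labels h (a i).bc_fst_ne_snd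
      (TTree.follow_mem_paths (fun j => (a j).pauli) _)
      (TTree.follow_mem_paths (fun j => (a j).pauli) _)
    have h4 := congrFun h1 i
    rw [branchPath, branchPath, h2, h3] at h4
    exact (a i).bc_fst_ne_snd (Option.some.inj h4)
  rcases h.pairing_cases a with h1 | h1 <;> rw [h1]
  · exact hne
  · exact hne.symm

/-- A string determines its path, and the path determines `i` as the last vertex left along an edge
other than the prescribed one. The two strings of one vertex differ at that vertex. -/
theorem TernaryTree.pairingString_injective (T : TernaryTree n) (a : Fin n → StabState) :
    Function.Injective (T.pairingString a) := by
  have hform : ∀ k : Fin n × Bool, ∃ anc c B, T.tree.At k.1 anc c ∧ B ≠ (a k.1).pauli ∧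
      T.pairingString a k = pathString (branchPath a anc k.1 c B) := by
    intro k
    obtain ⟨anc, c, h⟩ := T.exists_at k.1
    rw [TernaryTree.pairingString]
    rcases h.pairing_cases a with h1 | h1 <;> rw [h1] <;> split_ifs
    · exact ⟨anc, c, _, h, (a k.1).bc_snd_ne_pauli, rfl⟩
    · exact ⟨anc, c, _, h, (a k.1).bc_fst_ne_pauli, rfl⟩
    · exact ⟨anc, c, _, h, (a k.1).bc_fst_ne_pauli, rfl⟩
    · exact ⟨anc, c, _, h, (a k.1).bc_snd_ne_pauli, rfl⟩
  intro k k' hkk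
  have hfst : k.1 = k'.1 := by
    obtain ⟨anc, c, B, h, hB, hk⟩ := hform k
    obtain ⟨anc', c', B', h', hB', hk'⟩ := hform k'
    rw [hk, hk'] at hkk
    have hpath := pathString_injOn T.nodup_labels (h.branchPath_mem_paths a B)
      (h'.branchPath_mem_paths a B') hkk
    have h1 := getLast_filter_branchPath (anc := anc) (c := c) hB
    rw [hpath, getLast_filter_branchPath hB'] at h1
    exact (Prod.ext_iff.1 (Option.some.inj h1)).1.symm
  obtain ⟨i, b⟩ := k
  obtain ⟨i', b'⟩ := k'
  obtain rfl : i = i' := hfst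
  obtain ⟨anc, c, h⟩ := T.exists_at i
  have hne := h.pairing_fst_ne_snd (a := a)
  cases b <;> cases b' <;> simp [TernaryTree.pairingString] at hkk ⊢
  · exact hne hkk
  · exact hne hkk.symm

/-- This turns a product of signs over all qubits into the parity tested by the algorithm; distinct
keys ensure that no qubit is counted twice. -/
theorem prod_sign_eq_neg_one_pow_countP (m : Fin n → Bool) (l : List (Fin n × Pauli))
    (hl : (l.map Prod.fst).Nodup) :
    ∏ j, (if j ∈ l.map Prod.fst ∧ m j = true then (-1 : ℂ) else 1) =
      (-1) ^ l.countP fun e => m e.1 := by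
  induction l with
  | nil => simp
  | cons e l ih =>
    rw [List.map_cons, List.nodup_cons] at hl
    have hsplit : ∀ j, (if j ∈ (e :: l).map Prod.fst ∧ m j = true then (-1 : ℂ) else 1) =
        (if j = e.1 then (if m e.1 = true then -1 else 1) else 1) *
          (if j ∈ l.map Prod.fst ∧ m j = true then (-1 : ℂ) else 1) := by
      intro j
      by_cases hj : j = e.1
      · subst hj
        simp only [List.map_cons, List.mem_cons, true_or, true_and, if_true, hl.1, false_and,
          if_false, mul_one]
      · simp only [List.map_cons, List.mem_cons, hj, false_or, if_false, one_mul]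
    rw [Finset.prod_congr rfl fun j _ => hsplit j, Finset.prod_mul_distrib, ih hl.2,
      Finset.prod_ite_eq' Finset.univ e.1, if_pos (Finset.mem_univ _), List.countP_cons, pow_add,
      mul_comm]
    congr 1
    split_ifs <;> simp

theorem StabState.bc_mulVec_ket (b : StabState) :
    (b.bc.1.mat * b.bc.2.mat).mulVec b.ket = Complex.I • b.ket := by
  have h := (b.bc_spec b.bc.1 b.bc.2).2 rfl
  conv_rhs => rw [← h]
  rw [smul_smul, mul_neg, Complex.I_mul_I, neg_neg, one_smul]

/-- The action factorises over the sites: the common prefix squares to the identity, `i` contributes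
`B C` with eigenvalue `i`, and each vertex of the two disjoint tails contributes the sign of its
state. -/
theorem TTree.At.branchPath_mulVec (a : Fin n → StabState) (h : T.tree.At i anc c) :
    ((pathString (branchPath a anc i c (a i).bc.1)).op *
      (pathString (branchPath a anc i c (a i).bc.2)).op).mulVec (productState a) =
    (Complex.I * (-1) ^ (((c (a i).bc.1).follow (fun j => (a j).pauli) ++
        (c (a i).bc.2).follow (fun j => (a j).pauli)).countP fun e => (a e.1).isMinus)) •
      productState a := by
  set B := (a i).bc.1 with hB
  set C := (a i).bc.2 with hC
  set P : Fin n → Pauli := fun j => (a j).pauli with hP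
  set r := (c B).follow P with hr
  set r' := (c C).follow P with hr'
  have hBC : B ≠ C := (a i).bc_fst_ne_snd
  have hrp : r ∈ (c B).paths := TTree.follow_mem_paths _ _
  have hrp' : r' ∈ (c C).paths := TTree.follow_mem_paths _ _
  have hc := TTree.nodup_labels_node.1 (h.nodup_child T.nodup_labels)
  have hnd : ((r ++ r').map Prod.fst).Nodup := by
    rw [List.map_append, List.nodup_append]
    refine ⟨TTree.nodup_keys_of_mem_paths (hc.2.1 B) hrp,
      TTree.nodup_keys_of_mem_paths (hc.2.1 C) hrp', ?_⟩
    rintro x hx y hy rfl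
    obtain ⟨e, he, rfl⟩ := List.mem_map.1 hx
    obtain ⟨e', he', hee⟩ := List.mem_map.1 hy
    exact hc.2.2 B C hBC _ (TTree.mem_labels_of_mem_paths hrp he)
      (hee ▸ TTree.mem_labels_of_mem_paths hrp' he')
  have hi : i ∉ (r ++ r').map Prod.fst := by
    intro hi
    obtain ⟨e, he, rfl⟩ := List.mem_map.1 hi
    rcases List.mem_append.1 he with he | he
    · exact hc.1 B (TTree.mem_labels_of_mem_paths hrp he)
    · exact hc.1 C (TTree.mem_labels_of_mem_paths hrp' he)
  obtain ⟨h1, h2, h3⟩ := pathString_branch T.nodup_labels h hBC hrp hrp'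
  have hnone : ∀ (s : List (Fin n × Pauli)) (j : Fin n), s.lookup j = none →
      j ∉ s.map Prod.fst := by
    intro s j hs hj
    obtain ⟨e, he, rfl⟩ := List.mem_map.1 hj
    have := List.lookup_eq_none_iff.1 hs e he
    simp at this
  have hsome : ∀ (D : Pauli) (j : Fin n) (E : Pauli), ((c D).follow P).lookup j = some E →
      E = P j ∧ j ∈ ((c D).follow P).map Prod.fst := by
    intro D j E hs
    have hm := mem_of_lookup_eq_some hs
    exact ⟨TTree.eq_of_mem_follow hm, List.mem_map_of_mem hm⟩
  have hsite : ∀ j, (siteMat (pathString (branchPath a anc i c B) j) *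
      siteMat (pathString (branchPath a anc i c C) j)).mulVec (a j).ket =
      ((if j = i then Complex.I else 1) *
        (if j ∈ (r ++ r').map Prod.fst ∧ (a j).isMinus = true then (-1 : ℂ) else 1)) •
        (a j).ket := by
    intro j
    by_cases hj : j = i
    · subst hj
      rw [branchPath, branchPath, h1, h2, if_pos rfl, if_neg fun h' => hi h'.1, mul_one]
      exact (a j).bc_mulVec_ket
    · rw [if_neg hj, one_mul]
      simp only [List.map_append, List.mem_append]
      have hbp : ∀ D, branchPath a anc i c D = anc ++ (i, D) :: (c D).follow P := fun D => rfl
      rcases h3 j hj with ⟨h4, h5, h6⟩ | ⟨h4, h5, h6⟩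
      · rw [hbp, hbp, h4, siteMat_mul_self, Matrix.one_mulVec, if_neg, one_smul]
        rintro ⟨h7 | h7, -⟩
        · exact hnone _ _ h5 h7
        · exact hnone _ _ h6 h7
      · rw [hbp, hbp, h4, h5]
        cases hl : r.lookup j with
        | some E =>
          obtain ⟨rfl, hE⟩ := hsome B j E hl
          replace hE : j ∈ r.map Prod.fst := hE
          have h8 : r'.lookup j = none := h6.resolve_left (by simp [hl])
          rw [h8]
          simp only [hE, true_or, true_and]
          simpa [siteMat] using (a j).pauli_mulVec_ket
        | none =>
          cases hl' : r'.lookup j with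
          | some E =>
            obtain ⟨rfl, hE⟩ := hsome C j E hl'
            replace hE : j ∈ r'.map Prod.fst := hE
            simp only [hE, or_true, true_and]
            simpa [siteMat] using (a j).pauli_mulVec_ket
          | none =>
            rw [siteMat_mul_self, Matrix.one_mulVec, if_neg, one_smul]
            rintro ⟨h7 | h7, -⟩
            · exact hnone _ _ hl h7
            · exact hnone _ _ hl' h7
  rw [PauliString.op_mul_op_mulVec]
  simp_rw [hsite]
  rw [tensorVec_smul, Finset.prod_mul_distrib, Finset.prod_ite_eq' Finset.univ i,
    if_pos (Finset.mem_univ _),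
    prod_sign_eq_neg_one_pow_countP (fun j => (a j).isMinus) (r ++ r') hnd]
  rfl

/-- The members of a pair fulfil the vacuum condition on the product state. -/
theorem TernaryTree.pairing_mulVec (T : TernaryTree n) (a : Fin n → StabState) (i : Fin n) :
    ((T.pairing a i).1.op * (T.pairing a i).2.op).mulVec (productState a) =
      Complex.I • productState a := by
  obtain ⟨anc, c, h⟩ := T.exists_at i
  have h1 := h.branchPath_mulVec a
  rw [h.pairing_eq]
  split_ifs with he
  · rw [h1, he.neg_one_pow, mul_one]
  -- In the odd case the eigenvalue before the exchange is `-i`; swapping two anticommuting strings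
  -- negates it.
  · have h2 := clashOnlyAt_branch T.nodup_labels h (a i).bc_fst_ne_snd.symm
      (TTree.follow_mem_paths (fun j => (a j).pauli) _)
      (TTree.follow_mem_paths (fun j => (a j).pauli) _)
    have h3 := PauliString.op_anticomm h2
    rw [branchPath, branchPath] at h1 ⊢
    dsimp only
    rw [h3, Matrix.neg_mulVec, h1, (Nat.not_even_iff_odd.1 he).neg_one_pow, ← neg_smul]
    simp

/-- Two strings of the tree whose product has the product state as an eigenvector form a pair of
the pairing algorithm. -/
theorem TernaryTree.eq_pairing_of_mulVec (T : TernaryTree n) (a : Fin n → StabState)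
    {S S' : PauliString n} (hS : S ∈ T.strings) (hS' : S' ∈ T.strings) (hne : S ≠ S') {d : ℂ}
    (h : (S.op * S'.op).mulVec (productState a) = d • productState a) :
    ∃ i, (S = (T.pairing a i).1 ∧ S' = (T.pairing a i).2) ∨
      (S = (T.pairing a i).2 ∧ S' = (T.pairing a i).1) := by
  obtain ⟨l, hl, rfl⟩ := hS
  obtain ⟨l', hl', rfl⟩ := hS'
  obtain ⟨i, anc, c, hat, B, C, hBC, r, hr, r', hr', rfl, rfl⟩ :=
    TTree.exists_branch hl hl' fun h => hne (by rw [h])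
  obtain ⟨h1, h2, h3⟩ := pathString_branch T.nodup_labels hat hBC hr hr'
  have hsite := PauliString.exists_site_eigenvalue h
  have hc := TTree.nodup_labels_node.1 (hat.nodup_child T.nodup_labels)
  -- At `i` the product acts as `B C`; at a later vertex of one tail the other string is the
  -- identity, so the label alone must have the state as an eigenvector.
  have hbc : (B, C) = (a i).bc ∨ (C, B) = (a i).bc := by
    obtain ⟨e, he⟩ := hsite i
    rw [h1, h2] at he
    exact StabState.eq_bc_of_mulVec hBC he
  have hrf : r = (c B).follow fun j => (a j).pauli := by
    refine TTree.eq_follow hr fun e he => ?_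
    have hlk := lookup_eq_some_of_mem (TTree.nodup_keys_of_mem_paths (hc.2.1 B) hr) he
    have hei : e.1 ≠ i := fun h' => hc.1 B (h' ▸ TTree.mem_labels_of_mem_paths hr he)
    obtain ⟨d', hd'⟩ := hsite e.1
    rcases h3 e.1 hei with ⟨-, h5, -⟩ | ⟨h4, h5, h6⟩
    · simp [hlk] at h5
    · rw [h4, h5, hlk, h6.resolve_left (by simp [hlk])] at hd'
      exact StabState.eq_pauli_of_mulVec (c := d') (by simpa [siteMat] using hd')
  have hrf' : r' = (c C).follow fun j => (a j).pauli := by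
    refine TTree.eq_follow hr' fun e he => ?_
    have hlk := lookup_eq_some_of_mem (TTree.nodup_keys_of_mem_paths (hc.2.1 C) hr') he
    have hei : e.1 ≠ i := fun h' => hc.1 C (h' ▸ TTree.mem_labels_of_mem_paths hr' he)
    obtain ⟨d', hd'⟩ := hsite e.1
    rcases h3 e.1 hei with ⟨-, -, h5⟩ | ⟨h4, h5, h6⟩
    · simp [hlk] at h5
    · rw [h4, h5, hlk, h6.resolve_right (by simp [hlk])] at hd'
      exact StabState.eq_pauli_of_mulVec (c := d') (by simpa [siteMat] using hd')
  have e1 : anc ++ (i, B) :: r = branchPath a anc i c B := by rw [hrf, branchPath]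
  have e2 : anc ++ (i, C) :: r' = branchPath a anc i c C := by rw [hrf', branchPath]
  refine ⟨i, ?_⟩
  rw [e1, e2]
  rcases hbc with hbc | hbc <;> rcases hat.pairing_cases a with hp | hp <;>
    rw [hp, ← hbc] <;> simp

end Pairing

/-! ### Classification of the mappings with a given vacuum -/

section Main

variable {n : ℕ} {T : TernaryTree n} {a : Fin n → StabState}

/-- The four pairs that arise from a pair of operators by signs and braids. -/
def IsBraiding {n : ℕ} (p q : QubitOp n × QubitOp n) : Prop :=
  p = (q.1, q.2) ∨ p = (-q.1, -q.2) ∨ p = (q.2, -q.1) ∨ p = (-q.2, q.1)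

theorem isMajoranaFamily_of_strings {m : PairList n} {S : Fin n × Bool → PauliString n}
    (hS : Function.Injective S)
    (h : ∀ k, S k ∈ T.strings ∧ (m.majorana k = (S k).op ∨ m.majorana k = -(S k).op)) :
    IsMajoranaFamily m.majorana :=
  isMajoranaFamily_of_clash (fun k => (h k).2) fun k k' hk =>
    T.exists_clash (h k).1 (h k').1 fun hkk => hk (hS hkk)

/-- The minus sign of a braid cancels the one from anticommutation. For Majorana operators the
vacuum condition depends on the product only, so it cannot tell the four variants apart. -/
theorem IsBraiding.mul_eq {p q : QubitOp n × QubitOp n} (h : IsBraiding p q)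
    (hq : q.1 * q.2 = -(q.2 * q.1)) : p.1 * p.2 = q.1 * q.2 := by
  rcases h with rfl | rfl | rfl | rfl <;> simp [hq]

/-- If the product of two signed Pauli strings acts on a vector as the product of the unsigned
ones does, then the signs agree. -/
theorem signs_eq_of_mulVec {A B X Y : QubitOp n} {ψ : (Fin n → Fin 2) → ℂ} (hψ : ψ ≠ 0)
    (hX : X = A ∨ X = -A) (hY : Y = B ∨ Y = -B)
    (h : (A * B).mulVec ψ = Complex.I • ψ) (h' : (X * Y).mulVec ψ = Complex.I • ψ) :
    (X = A ∧ Y = B) ∨ (X = -A ∧ Y = -B) := by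
  have hne : -(Complex.I • ψ) ≠ Complex.I • ψ := by
    intro h0
    rw [← neg_smul] at h0
    have h1 := smul_left_injective ℂ hψ h0
    exact Complex.I_ne_zero (self_eq_neg.1 h1.symm)
  rcases hX with rfl | rfl <;> rcases hY with rfl | rfl
  · exact Or.inl ⟨rfl, rfl⟩
  · rw [mul_neg, Matrix.neg_mulVec, h] at h'
    exact absurd h' hne
  · rw [neg_mul, Matrix.neg_mulVec, h] at h'
    exact absurd h' hne
  · exact Or.inr ⟨rfl, rfl⟩

theorem TernaryTree.pairing_anticomm (T : TernaryTree n) (a : Fin n → StabState) (i : Fin n) :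
    (T.pairing a i).1.op * (T.pairing a i).2.op =
      -((T.pairing a i).2.op * (T.pairing a i).1.op) := by
  obtain ⟨anc, c, hat⟩ := T.exists_at i
  obtain ⟨j, hj⟩ := T.exists_clash (T.pairing_mem_strings a i).1 (T.pairing_mem_strings a i).2
    hat.pairing_fst_ne_snd
  exact PauliString.op_anticomm hj

/-- Relabelled, signed and braided pairs of the pairing algorithm form a mapping based on the
tree, with the given product state as its vacuum. -/
theorem isTreeBased_of_isBraiding {m : PairList n} (σ : Equiv.Perm (Fin n))
    (h : ∀ i, IsBraiding (m i) ((T.pairing a (σ i)).1.op, (T.pairing a (σ i)).2.op)) :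
    m.IsTreeBased T ∧ m.HasVacuum (productState a) := by
  -- The bit `b` records whether the pair is swapped; relabelling by `σ` and flipping by `b` is
  -- injective on indices, so the strings stay distinct.
  have hb : ∀ i, ∃ b : Bool, ∀ x, m.majorana (i, x) = (T.pairingString a (σ i, x ^^ b)).op ∨
      m.majorana (i, x) = -(T.pairingString a (σ i, x ^^ b)).op := by
    intro i
    rcases h i with h | h | h | h
    · exact ⟨false, fun x => by
        cases x <;> simp [PairList.majorana, TernaryTree.pairingString, h]⟩
    · exact ⟨false, fun x => by
        cases x <;> simp [PairList.majorana, TernaryTree.pairingString, h]⟩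
    · exact ⟨true, fun x => by
        cases x <;> simp [PairList.majorana, TernaryTree.pairingString, h]⟩
    · exact ⟨true, fun x => by
        cases x <;> simp [PairList.majorana, TernaryTree.pairingString, h]⟩
  choose b hb using hb
  have hinj : Function.Injective fun k : Fin n × Bool =>
      T.pairingString a (σ k.1, k.2 ^^ b k.1) := by
    rintro ⟨i, x⟩ ⟨i', x'⟩ hk
    have h1 := T.pairingString_injective a hk
    simp only [Prod.mk.injEq, EmbeddingLike.apply_eq_iff_eq] at h1
    obtain ⟨rfl, h2⟩ := h1
    simpa using h2
  have hmem : ∀ k : Fin n × Bool, T.pairingString a (σ k.1, k.2 ^^ b k.1) ∈ T.strings ∧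
      (m.majorana k = (T.pairingString a (σ k.1, k.2 ^^ b k.1)).op ∨
        m.majorana k = -(T.pairingString a (σ k.1, k.2 ^^ b k.1)).op) := fun k =>
    ⟨T.pairingString_mem a _, hb k.1 k.2⟩
  have hmaj := isMajoranaFamily_of_strings hinj hmem
  refine ⟨⟨hmaj.isFermionQubitMapping, _, hinj, hmem⟩, sum_norm_productState a, fun i => ?_⟩
  rw [annihilation_mulVec_eq_zero_iff hmaj, (h i).mul_eq (T.pairing_anticomm a (σ i))]
  exact T.pairing_mulVec a (σ i)

/-- Each mapping based on the tree with the given product state as its vacuum arises from the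
pairing algorithm by relabelling, signs and braids. -/
theorem exists_perm_isBraiding {m : PairList n} (hm : m.IsTreeBased T)
    (hv : m.HasVacuum (productState a)) : ∃ σ : Equiv.Perm (Fin n),
      ∀ i, IsBraiding (m i) ((T.pairing a (σ i)).1.op, (T.pairing a (σ i)).2.op) := by
  obtain ⟨-, S, hS, hmem⟩ := hm
  have hmaj := isMajoranaFamily_of_strings hS hmem
  have hvac : ∀ i, ((m i).1 * (m i).2).mulVec (productState a) =
      Complex.I • productState a := fun i =>
    (annihilation_mulVec_eq_zero_iff hmaj i _).1 (hv.2 i)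
  have h1 : ∀ i, (m i).1 = (S (i, false)).op ∨ (m i).1 = -(S (i, false)).op := fun i =>
    (hmem (i, false)).2
  have h2 : ∀ i, (m i).2 = (S (i, true)).op ∨ (m i).2 = -(S (i, true)).op := fun i =>
    (hmem (i, true)).2
  have hpair : ∀ i, ∃ j,
      (S (i, false) = (T.pairing a j).1 ∧ S (i, true) = (T.pairing a j).2) ∨
      (S (i, false) = (T.pairing a j).2 ∧ S (i, true) = (T.pairing a j).1) := by
    intro i
    have hne : S (i, false) ≠ S (i, true) := fun h => by simpa using hS h
    have h0 : ∃ d : ℂ, ((S (i, false)).op * (S (i, true)).op).mulVec (productState a) =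
        d • productState a := by
      have h3 := hvac i
      rcases h1 i with h | h <;> rcases h2 i with h' | h' <;> rw [h, h'] at h3
      · exact ⟨_, h3⟩
      · rw [mul_neg, Matrix.neg_mulVec, neg_eq_iff_eq_neg, ← neg_smul] at h3
        exact ⟨_, h3⟩
      · rw [neg_mul, Matrix.neg_mulVec, neg_eq_iff_eq_neg, ← neg_smul] at h3
        exact ⟨_, h3⟩
      · rw [neg_mul_neg] at h3
        exact ⟨_, h3⟩
    obtain ⟨d, hd⟩ := h0
    exact T.eq_pairing_of_mulVec a (hmem _).1 (hmem _).1 hne hd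
  choose σ hσ using hpair
  -- Two pairs assigned to the same vertex would share a string, against the injectivity of `S`.
  have hinj : Function.Injective σ := by
    intro i i' hii
    have hi := hσ i
    have hi' := hσ i'
    rw [← hii] at hi'
    rcases hi with hi | hi <;> rcases hi' with hi' | hi'
    · exact congrArg Prod.fst (hS (hi.1.trans hi'.1.symm))
    · exact congrArg Prod.fst (hS (hi.1.trans hi'.2.symm))
    · exact congrArg Prod.fst (hS (hi.1.trans hi'.2.symm))
    · exact congrArg Prod.fst (hS (hi.1.trans hi'.1.symm))
  refine ⟨Equiv.ofBijective σ (Finite.injective_iff_bijective.1 hinj), fun i => ?_⟩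
  rw [Equiv.ofBijective_apply]
  have hp := T.pairing_mulVec a (σ i)
  have h1 := h1 i
  have h2 := h2 i
  rcases hσ i with ⟨h3, h4⟩ | ⟨h3, h4⟩ <;> rw [h3] at h1 <;> rw [h4] at h2
  · rcases signs_eq_of_mulVec (productState_ne_zero a) h1 h2 hp (hvac i) with h | h
    · exact Or.inl (Prod.ext h.1 h.2)
    · exact Or.inr (Or.inl (Prod.ext h.1 h.2))
  -- In swapped order the reference pair with eigenvalue `i` is the second string and the negated
  -- first one.
  · have hp' : ((T.pairing a (σ i)).2.op * -(T.pairing a (σ i)).1.op).mulVec (productState a) =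
        Complex.I • productState a := by
      rw [mul_neg, ← T.pairing_anticomm, hp]
    have h2' : (m i).2 = -(T.pairing a (σ i)).1.op ∨ (m i).2 = - -(T.pairing a (σ i)).1.op := by
      rw [neg_neg]
      exact h2.symm
    rcases signs_eq_of_mulVec (productState_ne_zero a) h1 h2' hp' (hvac i) with h | h
    · exact Or.inr (Or.inr (Or.inl (Prod.ext h.1 h.2)))
    · exact Or.inr (Or.inr (Or.inr (Prod.ext h.1 (h.2.trans (neg_neg _)))))

/-- The operators of two strings of a tree do not differ by a sign. -/
theorem TernaryTree.op_ne_neg_op (T : TernaryTree n) {S S' : PauliString n} (hS : S ∈ T.strings)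
    (hS' : S' ∈ T.strings) : S.op ≠ -S'.op := by
  intro h
  by_cases hne : S = S'
  · subst hne
    exact S.op_ne_neg_op h
  -- Distinct strings anticommute, whereas opposite matrices commute; together these give `-1 = 1`.
  · obtain ⟨i, hi⟩ := T.exists_clash hS hS' hne
    have h1 := PauliString.op_anticomm hi
    rw [h, neg_mul, mul_neg, neg_neg, S'.op_mul_self] at h1
    have h2 := congrFun (congrFun h1 0) 0
    simp at h2
    norm_num [self_eq_neg] at h2

/-- Each of the other three variants contains a negated string, which is not the operator of any
string of the tree. -/
theorem eq_pairing_of_isUnsigned {m : PairList n} (hm : m.IsUnsigned T) {i j : Fin n}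
    (h : IsBraiding (m i) ((T.pairing a j).1.op, (T.pairing a j).2.op)) :
    m i = ((T.pairing a j).1.op, (T.pairing a j).2.op) := by
  obtain ⟨S, hS, h1⟩ := hm (i, false)
  obtain ⟨S', hS', h2⟩ := hm (i, true)
  have h1 : (m i).1 = S.op := h1
  have h2 : (m i).2 = S'.op := h2
  have hp := T.pairing_mem_strings a j
  rcases h with h | h | h | h
  · exact h
  · rw [h] at h1
    exact absurd h1.symm (T.op_ne_neg_op hS hp.1)
  · rw [h] at h2
    exact absurd h2.symm (T.op_ne_neg_op hS' hp.1)
  · rw [h] at h1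
    exact absurd h1.symm (T.op_ne_neg_op hS hp.2)

end Main

theorem mainTheorem3 {n : ℕ} (T : TernaryTree n) (a : Fin n → StabState) :
    -- part a): the pairing algorithm gives a mapping with the prescribed vacuum state,
    -- which is the only unsigned one up to fermionic relabelling
    ((∀ i, (T.pairing a i).1 ∈ T.strings ∧ (T.pairing a i).2 ∈ T.strings) ∧
      PairList.IsTreeBased T (fun i => ((T.pairing a i).1.op, (T.pairing a i).2.op)) ∧
      PairList.HasVacuum (fun i => ((T.pairing a i).1.op, (T.pairing a i).2.op))
        (productState a) ∧
      ∀ m : PairList n,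
        (m.IsTreeBased T ∧ m.IsUnsigned T ∧ m.HasVacuum (productState a)) ↔
          ∃ σ : Equiv.Perm (Fin n), ∀ i,
            m i = ((T.pairing a (σ i)).1.op, (T.pairing a (σ i)).2.op)) ∧
    -- part b): all mappings with this vacuum state, up to relabelling, signs and braids
    ∀ m : PairList n,
      (m.IsTreeBased T ∧ m.HasVacuum (productState a)) ↔
        ∃ σ : Equiv.Perm (Fin n), ∀ i,
          m i = ((T.pairing a (σ i)).1.op, (T.pairing a (σ i)).2.op) ∨
          m i = (-(T.pairing a (σ i)).1.op, -(T.pairing a (σ i)).2.op) ∨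
          m i = ((T.pairing a (σ i)).2.op, -(T.pairing a (σ i)).1.op) ∨
          m i = (-(T.pairing a (σ i)).2.op, (T.pairing a (σ i)).1.op) := by
  have hid := isTreeBased_of_isBraiding (T := T) (a := a)
    (m := fun i => ((T.pairing a i).1.op, (T.pairing a i).2.op)) (Equiv.refl _)
    fun i => Or.inl rfl
  refine ⟨⟨T.pairing_mem_strings a, hid.1, hid.2, fun m => ⟨?_, ?_⟩⟩, fun m => ⟨?_, ?_⟩⟩
  · rintro ⟨hm, hu, hv⟩
    obtain ⟨σ, hσ⟩ := exists_perm_isBraiding hm hv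
    exact ⟨σ, fun i => eq_pairing_of_isUnsigned hu (hσ i)⟩
  · rintro ⟨σ, hσ⟩
    obtain ⟨hm, hv⟩ := isTreeBased_of_isBraiding σ fun i => Or.inl (hσ i)
    refine ⟨hm, ?_, hv⟩
    rintro ⟨i, x⟩
    have hp := T.pairing_mem_strings a (σ i)
    cases x
    · exact ⟨_, hp.1, by simp [PairList.majorana, hσ i]⟩
    · exact ⟨_, hp.2, by simp [PairList.majorana, hσ i]⟩
  · rintro ⟨hm, hv⟩
    exact exists_perm_isBraiding hm hv
  · rintro ⟨σ, hσ⟩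
    exact isTreeBased_of_isBraiding σ hσ
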